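/- **Setting (special relativistic magnetohydrodynamics, speed of light $1$).** Let the equation of state $H=H(p,\rho)$ (specific enthalpy) be differentiable on $\mathbb R^+\times\mathbb R^+$ and satisfy, for all $p,\rho>0$, $$H\ge\sqrt{1+p^2/\rho^2}+p/\rho,\qquad H\Big(\frac1\rho-\frac{\partial H}{\partial p}\Big)<\frac{\partial H}{\partial\rho}<0,\qquad \lim_{p\to0^+}H(p,\rho)=1 .$$ Primitive variables $\rho,p\in\mathbb R$, $\mathbf v,\mathbf B\in\mathbb R^3$ give, with $W=(1-|\mathbf v|^2)^{-1/2}$, $p_{tot}=p+\frac12(W^{-2}|\mathbf B|^2+(\mathbf v\cdot\mathbf B)^2)$ and $\mathbf G=(1-|\mathbf v|^2)\mathbf B+(\mathbf v\cdot\mathbf B)\mathbf v$, the state $\mathbf U=(D,\mathbf m,\mathbf B,E)\in\mathbb R^8$, where $$D=\rho W,\quad \mathbf m=(\rho HW^2+|\mathbf B|^2)\mathbf v-(\mathbf v\cdot\mathbf B)\mathbf B,\quad E=\rho HW^2-p_{tot}+|\mathbf B|^2 .$$ The admissible set $\mathcal G$ consists of the states arising from primitive variables with $\rho>0$, $p>0$,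 $e=H-1-p/\rho>0$, $|\mathbf v|<1$. For $\mathbf U\in\mathcal G$, with its primitive variables, put $$\mathbf F_i(\mathbf U)=(Dv_i,\;v_i\mathbf m-B_i\mathbf G+p_{tot}\mathbf e_i,\;v_i\mathbf B-B_i\mathbf v,\;m_i)\ (i=1,2),\qquad \mathbf S(\mathbf U)=(0,\mathbf G,\mathbf v,\mathbf v\cdot\mathbf B),$$ and for $\mathbf n\in\mathbb R^2$ put $\langle\mathbf n,\mathbf F\rangle=\sum_{i=1}^2n_i\mathbf F_i$, $\langle\mathbf n,\mathbf B\rangle=\sum_{i=1}^2n_iB_i$. **Mesh and space.** Let a planar domain be partitioned into a mesh $\mathcal T_h$ of polygonal cells $K$ (area $|K|$, edges $\mathscr E\in\partial K$ of length $|\mathscr E|$, outward unit normals $\mathbf n_{\mathscr E,K}$), where each edge of a cell is either an edge of exactly one other cell or lies on the boundary of the domain. Let $k\ge0$, and let $\mathbb W_h^k$ be the space of functions $\mathbf u=(u_1,\dots,u_8)$ whose components on each cell are polynomials of total degree at most $k$, with $\partial_{x_1}u_5+\partial_{x_2}u_6=0$ on each cell. **Quadratures.** On every edge use the $Q$-point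 quadrature with points $\mathbf x_{\mathscr E}^{(q)}\in\mathscr E$ and positive weights $\omega_q$, obtained from a rule on $[0,1]$ exact for degree at most $2k$ (e.g. Gauss with $Q=k+1$). On every cell $K$ use a quadrature with points $\breve{\mathbf x}_K^{(q)}\in K$ and weights $\breve\omega_q$ (times $|K|$), exact for degree at most $2k$. Assume moreover that on each cell there is a special quadrature with positive weights $\varpi_{\mathscr E}^{(q)},\widetilde\varpi_q$ (which may depend on $K$) and further points $\widetilde{\mathbf x}_K^{(q)}\in K$ such that, for all polynomials $u$ of total degree at most $k$, $$\frac1{|K|}\int_Ku\,d\mathbf x=\sum_{\mathscr E\in\partial K}\sum_{q=1}^Q\varpi_{\mathscr E}^{(q)}u(\mathbf x_{\mathscr E}^{(q)})+\sum_q\widetilde\varpi_q\,u(\widetilde{\mathbf x}_K^{(q)}).$$ Let $\mathbb S_K$ be the set of all points $\mathbf x_{\mathscr E}^{(q)}$ ($\mathscr E\in\partial K$), $\widetilde{\mathbf x}_K^{(q)}$ and $\breve{\mathbf x}_K^{(q)}$. Let $\overline{\mathbb G}_h^k$ be the set of $\mathbf u\in\mathbb W_h^k$ with cell averages $\frac1{|K|}\int_K\mathbf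 u\,d\mathbf x\in\mathcal G$ for all $K$, and $\mathbb G_h^k$ the set of $\mathbf u\in\overline{\mathbb G}_h^k$ with $\mathbf u|_K(\mathbf x)\in\mathcal G$ for all $\mathbf x\in\mathbb S_K$ and all $K$. **Scheme.** For $\mathbf U_h\in\mathbb W_h^k$, let $\mathbf U^{\rm int(K)}_{\mathscr E,q}$ be the value at $\mathbf x_{\mathscr E}^{(q)}$ of $\mathbf U_h|_K$, and $\mathbf U^{\rm ext(K)}_{\mathscr E,q}$ that of $\mathbf U_h|_{K'}$ for the other cell $K'$ with edge $\mathscr E$; if $\mathscr E$ lies on the boundary of the domain, $\mathbf U^{\rm ext(K)}_{\mathscr E,q}$ is a prescribed state in $\mathcal G$. With $a=1$ let $$\hat{\mathbf F}(\mathbf U,\mathbf U';\mathbf n)=\tfrac12\big(\langle\mathbf n,\mathbf F(\mathbf U)+\mathbf F(\mathbf U')\rangle-a(\mathbf U'-\mathbf U)\big).$$ The operator $\mathbf L_h$ is defined by $\mathbf L_h(\mathbf U_h)\in\mathbb W_h^k$ and, for all $K$ and all $\mathbf u\in\mathbb W_h^k$, $$\int_K\mathbf L_h(\mathbf U_h)\cdot\mathbf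 u\,d\mathbf x=-\sum_{\mathscr E\in\partial K}|\mathscr E|\sum_{q=1}^Q\omega_q\Big[\hat{\mathbf F}(\mathbf U^{\rm int(K)}_{\mathscr E,q},\mathbf U^{\rm ext(K)}_{\mathscr E,q};\mathbf n_{\mathscr E,K})+\tfrac12\big\langle\mathbf n_{\mathscr E,K},\mathbf B^{\rm ext(K)}_{\mathscr E,q}-\mathbf B^{\rm int(K)}_{\mathscr E,q}\big\rangle\mathbf S(\mathbf U^{\rm int(K)}_{\mathscr E,q})\Big]\cdot\mathbf u|_K(\mathbf x_{\mathscr E}^{(q)})$$ $$\qquad+|K|\sum_q\breve\omega_q\sum_{i=1}^2\mathbf F_i\big(\mathbf U_h|_K(\breve{\mathbf x}_K^{(q)})\big)\cdot\partial_{x_i}\mathbf u|_K(\breve{\mathbf x}_K^{(q)}).$$ **Theorem (weak physical-constraint-preserving property).** Let $\mathbf U_h\in\mathbb G_h^k$ and $\Delta t>0$, and suppose that $$\Delta t\,\frac{|\mathscr E|}{|K|}\big(a+\sigma_{K,\mathscr E,q}(\mathbf U_h)\big)<\frac{\varpi_{\mathscr E}^{(q)}}{\omega_q}\qquad\text{for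 all }1\le q\le Q,\ \mathscr E\in\partial K,\ K\in\mathcal T_h,$$ where $$\sigma_{K,\mathscr E,q}(\mathbf U_h)=\frac12\,\frac{\big|\langle\mathbf n_{\mathscr E,K},\mathbf B^{\rm int(K)}_{\mathscr E,q}-\mathbf B^{\rm ext(K)}_{\mathscr E,q}\rangle\big|}{\sqrt{\rho^{\rm int(K)}_{\mathscr E,q}H^{\rm int(K)}_{\mathscr E,q}}}$$ and $\rho^{\rm int(K)}_{\mathscr E,q},H^{\rm int(K)}_{\mathscr E,q}$ are the density and enthalpy of $\mathbf U^{\rm int(K)}_{\mathscr E,q}$. Then $\mathbf U_h+\Delta t\,\mathbf L_h(\mathbf U_h)\in\overline{\mathbb G}_h^k$. -/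

import Mathlib

open MeasureTheory Set Filter Topology
open scoped Matrix

namespace RMHD

/-! ### States, equation of state, flux and source -/

/-- Vectors of `ℝ³`; the Euclidean products are written with the dot product `⬝ᵥ`. -/
abbrev Vec3 := Fin 3 → ℝ

/-- Conservative vectors `U = (D, m, B, E)`, with `D = U 0`, `m = (U 1, U 2, U 3)`,
`B = (U 4, U 5, U 6)` and `E = U 7`. -/
abbrev State := Fin 8 → ℝ

/-- Points of the plane with the Euclidean distance. -/
abbrev Pt := EuclideanSpace ℝ (Fin 2)

def mkState (D : ℝ) (m B : Vec3) (E : ℝ) : State :=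
  ![D, m 0, m 1, m 2, B 0, B 1, B 2, E]

def magnetic (U : State) : Vec3 := ![U 4, U 5, U 6]

/-- A general causal equation of state `H = H(p, ρ)`, giving the specific enthalpy.
The last field says that the internal energy `e = H - 1 - p / ρ` vanishes with the pressure. -/
structure CausalEOS (H : ℝ → ℝ → ℝ) : Prop where
  differentiable : DifferentiableOn ℝ (fun z : ℝ × ℝ => H z.1 z.2) (Ioi 0 ×ˢ Ioi 0)
  kinetic : ∀ p ρ : ℝ, 0 < p → 0 < ρ → √(1 + p ^ 2 / ρ ^ 2) + p / ρ ≤ H p ρ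
  causal : ∀ p ρ : ℝ, 0 < p → 0 < ρ →
    H p ρ * (1 / ρ - deriv (fun s => H s ρ) p) < deriv (fun s => H p s) ρ
  expansion : ∀ p ρ : ℝ, 0 < p → 0 < ρ → deriv (fun s => H p s) ρ < 0
  cold : ∀ ρ : ℝ, 0 < ρ → Tendsto (fun p => H p ρ) (𝓝[>] 0) (𝓝 1)

/-- Primitive variables: rest-mass density, thermal pressure, velocity, magnetic field. -/
structure Prim where
  ρ : ℝ
  p : ℝ
  v : Vec3
  B : Vec3

namespace Prim

/-- The Lorentz factor. -/
noncomputable def W (w : Prim) : ℝ := 1 / √(1 - w.v ⬝ᵥ w.v)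

/-- The specific enthalpy. -/
def enthalpy (H : ℝ → ℝ → ℝ) (w : Prim) : ℝ := H w.p w.ρ

/-- The specific internal energy, from `H = 1 + e + p / ρ`. -/
noncomputable def energy (H : ℝ → ℝ → ℝ) (w : Prim) : ℝ := w.enthalpy H - 1 - w.p / w.ρ

/-- The total pressure: thermal pressure plus magnetic pressure. -/
noncomputable def ptot (w : Prim) : ℝ :=
  w.p + (1 / 2) * (w.B ⬝ᵥ w.B / w.W ^ 2 + (w.v ⬝ᵥ w.B) ^ 2)

noncomputable def momentum (H : ℝ → ℝ → ℝ) (w : Prim) : Vec3 :=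
  (w.ρ * w.enthalpy H * w.W ^ 2 + w.B ⬝ᵥ w.B) • w.v - (w.v ⬝ᵥ w.B) • w.B

/-- The conservative vector of a set of primitive variables. -/
noncomputable def cons (H : ℝ → ℝ → ℝ) (w : Prim) : State :=
  mkState (w.ρ * w.W) (w.momentum H) w.B
    (w.ρ * w.enthalpy H * w.W ^ 2 - w.ptot + w.B ⬝ᵥ w.B)

/-- The vector `W⁻² B + (v · B) v`, which equals `(1 - |v|²) B + (v · B) v`. -/
noncomputable def inducedField (w : Prim) : Vec3 :=
  (1 - w.v ⬝ᵥ w.v) • w.B + (w.v ⬝ᵥ w.B) • w.v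

/-- The flux in direction `i` (the two space directions are the first two of `ℝ³`). -/
noncomputable def flux (H : ℝ → ℝ → ℝ) (w : Prim) (i : Fin 2) : State :=
  mkState (w.ρ * w.W * w.v i.castSucc)
    (w.v i.castSucc • w.momentum H - w.B i.castSucc • w.inducedField
      + w.ptot • Pi.single i.castSucc 1)
    (w.v i.castSucc • w.B - w.B i.castSucc • w.v)
    (w.momentum H i.castSucc)

/-- The coefficient of `-∇ · B` in the symmetrizable formulation. -/
noncomputable def source (w : Prim) : State :=
  mkState 0 w.inducedField w.v (w.v ⬝ᵥ w.B)

/-- Physically meaningful primitive variables. -/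
def IsPhysical (H : ℝ → ℝ → ℝ) (w : Prim) : Prop :=
  0 < w.ρ ∧ 0 < w.p ∧ 0 < w.energy H ∧ w.v ⬝ᵥ w.v < 1

end Prim

/-- The set of admissible states: conservative vectors with physical primitive variables. -/
def admissible (H : ℝ → ℝ → ℝ) : Set State :=
  {U | ∃ w : Prim, w.IsPhysical H ∧ w.cons H = U}

open Classical in
/-- The primitive variables recovered from a state (only used on `admissible H`). -/
noncomputable def prim (H : ℝ → ℝ → ℝ) (U : State) : Prim :=
  if h : U ∈ admissible H then h.choose else ⟨0, 0, 0, 0⟩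

theorem prim_spec {H : ℝ → ℝ → ℝ} {U : State} (h : U ∈ admissible H) :
    (prim H U).IsPhysical H ∧ (prim H U).cons H = U := by
  rw [prim, dif_pos h]
  exact h.choose_spec

/-- The flux `F_i(U)` as a function of the conservative vector. -/
noncomputable def flux (H : ℝ → ℝ → ℝ) (i : Fin 2) (U : State) : State := (prim H U).flux H i

/-- The source coefficient `S(U)` as a function of the conservative vector. -/
noncomputable def source (H : ℝ → ℝ → ℝ) (U : State) : State := (prim H U).source

/-- `⟨n, F(U)⟩`. -/
noncomputable def normalFlux (H : ℝ → ℝ → ℝ) (n : Pt) (U : State) : State :=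
  ∑ i : Fin 2, n i • flux H i U

/-- `⟨n, B⟩`. -/
def normalB (n : Pt) (U : State) : ℝ := ∑ i : Fin 2, n i * magnetic U i.castSucc

/-- The numerical viscosity of the global Lax-Friedrichs flux: the speed of light. -/
def viscosity : ℝ := 1

/-- The global Lax-Friedrichs flux. -/
noncomputable def laxFriedrichs (H : ℝ → ℝ → ℝ) (Uint Uext : State) (n : Pt) : State :=
  (1 / 2 : ℝ) • (normalFlux H n Uint + normalFlux H n Uext - viscosity • (Uext - Uint))

/-! ### Polygonal meshes -/

/-- A mesh of polygonal cells, with cells indexed by `ι` and edges by `ε`.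
A cell is a compact set with connected interior whose boundary consists of finitely many
segments, which overlap at end points at most, the cell lying locally on one side of each.
Edges are shared by neighbouring cells, so that a hanging node counts as a vertex of every cell
on whose boundary it lies. -/
structure PolygonalMesh (ι ε : Type*) where
  /-- the spatial domain -/
  domain : Set Pt
  cell : ι → Set Pt
  /-- the edges of a cell -/
  edges : ι → Finset ε
  /-- the end points of an edge -/
  src : ε → Pt
  tgt : ε → Pt
  /-- the outward unit normal to an edge of a cell -/
  normal : ι → ε → Pt
  isOpen_domain : IsOpen domain
  isCompact_cell : ∀ K, IsCompact (cell K)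
  isConnected_interior : ∀ K, IsConnected (interior (cell K))
  src_ne_tgt : ∀ e, src e ≠ tgt e
  frontier_cell : ∀ K, frontier (cell K) = ⋃ e ∈ edges K, segment ℝ (src e) (tgt e)
  edges_disjoint : ∀ K, ∀ e ∈ edges K, ∀ e' ∈ edges K, e ≠ e' →
    Disjoint (openSegment ℝ (src e) (tgt e)) (segment ℝ (src e') (tgt e'))
  norm_normal : ∀ K, ∀ e ∈ edges K, ‖normal K e‖ = 1
  normal_orthogonal : ∀ K, ∀ e ∈ edges K, inner ℝ (normal K e) (tgt e - src e) = 0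
  normal_outward : ∀ K, ∀ e ∈ edges K, ∀ x ∈ openSegment ℝ (src e) (tgt e),
    ∀ᶠ y in 𝓝 x, y ∈ cell K ↔ inner ℝ (normal K e) (y - x) ≤ 0
  interior_disjoint : ∀ K K', K ≠ K' → Disjoint (interior (cell K)) (interior (cell K'))
  locallyFinite : LocallyFinite cell
  interior_subset : ∀ K, interior (cell K) ⊆ domain
  iUnion_cell : ⋃ K, cell K = closure domain
  /-- an edge is either shared with another cell or lies on the boundary of the domain -/
  shared_or_boundary : ∀ K, ∀ e ∈ edges K,
    (openSegment ℝ (src e) (tgt e) ⊆ domain ∧ ∃ K', K' ≠ K ∧ e ∈ edges K') ∨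
    (segment ℝ (src e) (tgt e) ⊆ frontier domain ∧ ∀ K', K' ≠ K → e ∉ edges K')

namespace PolygonalMesh

variable {ι ε : Type*} (M : PolygonalMesh ι ε)

/-- `|K|`, the area of a cell. -/
noncomputable def area (K : ι) : ℝ := volume.real (M.cell K)

/-- `|E|`, the length of an edge. -/
noncomputable def length (e : ε) : ℝ := dist (M.src e) (M.tgt e)

/-- The point of an edge with parameter `t ∈ [0,1]`. -/
noncomputable def edgePoint (e : ε) (t : ℝ) : Pt := AffineMap.lineMap (M.src e) (M.tgt e) t

end PolygonalMesh

/-! ### The locally divergence-free space -/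

/-- Vector polynomials in two variables with eight components. -/
abbrev PolyVec := Fin 8 → MvPolynomial (Fin 2) ℝ

/-- The value of a polynomial at a point. -/
noncomputable def pval (f : MvPolynomial (Fin 2) ℝ) (x : Pt) : ℝ :=
  MvPolynomial.eval (fun i => x i) f

/-- The value of a vector polynomial at a point. -/
noncomputable def valueAt (u : PolyVec) (x : Pt) : State := fun l => pval (u l) x

/-- The restriction of the space `W_h^k` to one cell: polynomials of total degree at most `k`
whose magnetic part satisfies `∂₁ B₁ + ∂₂ B₂ = 0`. -/
noncomputable def localSpace (k : ℕ) : Submodule ℝ PolyVec where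
  carrier := {u | (∀ l, u l ∈ MvPolynomial.restrictTotalDegree (Fin 2) ℝ k) ∧
    MvPolynomial.pderiv 0 (u 4) + MvPolynomial.pderiv 1 (u 5) = 0}
  add_mem' := by
    rintro u v ⟨hu, hu'⟩ ⟨hv, hv'⟩
    refine ⟨fun l => Submodule.add_mem _ (hu l) (hv l), ?_⟩
    simp only [Pi.add_apply, map_add]
    linear_combination hu' + hv'
  zero_mem' := ⟨fun l => Submodule.zero_mem _, by simp⟩
  smul_mem' := by
    rintro c u ⟨hu, hu'⟩
    refine ⟨fun l => Submodule.smul_mem _ c (hu l), ?_⟩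
    rw [Pi.smul_apply, Pi.smul_apply, Derivation.map_smul, Derivation.map_smul, ← smul_add, hu',
      smul_zero]

/-- The locally divergence-free space `W_h^k`: one vector polynomial on each cell. -/
noncomputable def dgSpace (ι : Type*) (k : ℕ) : Submodule ℝ (ι → PolyVec) :=
  Submodule.pi Set.univ (fun _ => localSpace k)

/-! ### Quadratures -/

/-- A quadrature on `[0,1]` with `Q` points and positive weights, exact for polynomials of degree
at most `2k`; it is transported to each edge.  The Gauss quadrature with `Q = k + 1` points is
one. -/
structure EdgeQuadrature (k Q : ℕ) where
  node : Fin Q → ℝ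
  weight : Fin Q → ℝ
  node_mem : ∀ q, node q ∈ Icc (0 : ℝ) 1
  weight_pos : ∀ q, 0 < weight q
  exact_integral : ∀ f : Polynomial ℝ, f.natDegree ≤ 2 * k →
    ∑ q, weight q * f.eval (node q) = ∫ t in (0 : ℝ)..1, f.eval t

/-- A quadrature on a cell, exact for polynomials of total degree at most `2k`. -/
structure CellQuadrature (k : ℕ) (K : Set Pt) where
  card : ℕ
  node : Fin card → Pt
  weight : Fin card → ℝ
  node_mem : ∀ q, node q ∈ K
  exact_integral : ∀ f : MvPolynomial (Fin 2) ℝ, f.totalDegree ≤ 2 * k →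
    volume.real K * ∑ q, weight q * pval f (node q) = ∫ x in K, pval f x

/-- The special quadrature on a cell `K`: it has positive weights, is exact for polynomials of
total degree at most `k`, and its points include all the edge quadrature points of `K`. -/
structure SpecialQuadrature {ι ε : Type*} (M : PolygonalMesh ι ε) {k Q : ℕ}
    (R : EdgeQuadrature k Q) (K : ι) where
  edgeWeight : ε → Fin Q → ℝ
  card : ℕ
  node : Fin card → Pt
  weight : Fin card → ℝ
  edgeWeight_pos : ∀ e ∈ M.edges K, ∀ q, 0 < edgeWeight e q
  weight_pos : ∀ q, 0 < weight q
  node_mem : ∀ q, node q ∈ M.cell K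
  exact_average : ∀ f : MvPolynomial (Fin 2) ℝ, f.totalDegree ≤ k →
    (M.area K)⁻¹ * ∫ x in M.cell K, pval f x =
      ∑ e ∈ M.edges K, ∑ q, edgeWeight e q * pval f (M.edgePoint e (R.node q))
        + ∑ q, weight q * pval f (node q)

/-! ### The semi-discrete scheme -/

section Scheme

variable {ι ε : Type*} (H : ℝ → ℝ → ℝ) (M : PolygonalMesh ι ε) {k Q : ℕ}
  (R : EdgeQuadrature k Q) (C : ∀ K, CellQuadrature k (M.cell K)) (g : ε → Fin Q → State)

/-- The interior limit of `U_h` at the `q`-th quadrature point of the edge `e` of the cell `K`. -/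
noncomputable def intState (U : ι → PolyVec) (K : ι) (e : ε) (q : Fin Q) : State :=
  valueAt (U K) (M.edgePoint e (R.node q))

open Classical in
/-- The exterior limit of `U_h` at the `q`-th quadrature point of the edge `e` of the cell `K`:
the value from the other cell that has the edge `e`, or the prescribed exterior state `g e q` if
`e` lies on the boundary of the domain. -/
noncomputable def extState (U : ι → PolyVec) (K : ι) (e : ε) (q : Fin Q) : State :=
  if h : ∃ K', K' ≠ K ∧ e ∈ M.edges K' then valueAt (U h.choose) (M.edgePoint e (R.node q))
  else g e q

/-- The Lax-Friedrichs flux plus the source discretization at an edge quadrature point. -/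
noncomputable def edgeTerm (U : ι → PolyVec) (K : ι) (e : ε) (q : Fin Q) : State :=
  laxFriedrichs H (intState M R U K e q) (extState M R g U K e q) (M.normal K e)
    + ((1 / 2) * (normalB (M.normal K e) (extState M R g U K e q)
          - normalB (M.normal K e) (intState M R U K e q))) • source H (intState M R U K e q)

/-- The right-hand side `J_K(U_h, u)` of the weak formulation; only `u` on the cell `K`
matters. -/
noncomputable def rhs (U : ι → PolyVec) (K : ι) (u : PolyVec) : ℝ :=
  -(∑ e ∈ M.edges K, M.length e * ∑ q, R.weight q *
      (edgeTerm H M R g U K e q ⬝ᵥ valueAt u (M.edgePoint e (R.node q))))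
    + M.area K * ∑ q, (C K).weight q * ∑ i : Fin 2,
        flux H i (valueAt (U K) ((C K).node q)) ⬝ᵥ
          valueAt (fun l => MvPolynomial.pderiv i (u l)) ((C K).node q)

theorem pval_add (f g : MvPolynomial (Fin 2) ℝ) (x : Pt) :
    pval (f + g) x = pval f x + pval g x := by simp [pval]

theorem pval_smul (c : ℝ) (f : MvPolynomial (Fin 2) ℝ) (x : Pt) :
    pval (c • f) x = c * pval f x := by simp [pval]

theorem valueAt_add (u v : PolyVec) (x : Pt) : valueAt (u + v) x = valueAt u x + valueAt v x := by
  funext l; simp [valueAt, pval_add]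

theorem valueAt_smul (c : ℝ) (u : PolyVec) (x : Pt) : valueAt (c • u) x = c • valueAt u x := by
  funext l; simp [valueAt, pval_smul]

theorem continuous_pval (f : MvPolynomial (Fin 2) ℝ) : Continuous (pval f) := by
  unfold pval
  exact (MvPolynomial.continuous_eval f).comp (by fun_prop)

theorem continuous_dot (u v : PolyVec) :
    Continuous (fun x => valueAt u x ⬝ᵥ valueAt v x) := by
  unfold dotProduct valueAt
  exact continuous_finsetSum _ fun l _ => (continuous_pval _).mul (continuous_pval _)

theorem rhs_add (U : ι → PolyVec) (K : ι) (u v : PolyVec) :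
    rhs H M R C g U K (u + v) = rhs H M R C g U K u + rhs H M R C g U K v := by
  have h : ∀ i : Fin 2, (fun l => MvPolynomial.pderiv i ((u + v) l))
      = (fun l => MvPolynomial.pderiv i (u l)) + fun l => MvPolynomial.pderiv i (v l) := by
    intro i; funext l; simp
  simp only [rhs, h, valueAt_add, dotProduct_add, mul_add, Finset.sum_add_distrib]
  ring

theorem rhs_smul (U : ι → PolyVec) (K : ι) (c : ℝ) (u : PolyVec) :
    rhs H M R C g U K (c • u) = c * rhs H M R C g U K u := by
  have h : ∀ i : Fin 2, (fun l => MvPolynomial.pderiv i ((c • u) l))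
      = c • fun l => MvPolynomial.pderiv i (u l) := by
    intro i; funext l; simp
  simp only [rhs, h, valueAt_smul, dotProduct_smul, smul_eq_mul, mul_add, Finset.mul_sum]
  rw [← Finset.sum_neg_distrib, ← Finset.sum_neg_distrib, Finset.mul_sum]
  congr 1
  · refine Finset.sum_congr rfl fun e _ => ?_
    rw [mul_neg, Finset.mul_sum]
    congr 1
    exact Finset.sum_congr rfl fun q _ => by ring
  · exact Finset.sum_congr rfl fun q _ => Finset.sum_congr rfl fun i _ => by ring

end Scheme

/-- A vector polynomial whose square integral over a compact set with interior points vanishes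
is zero. -/
theorem eq_zero_of_integral_eq_zero {K : Set Pt} (hK : IsCompact K) (hi : (interior K).Nonempty)
    (u : PolyVec) (h : ∫ x in K, valueAt u x ⬝ᵥ valueAt u x = 0) : u = 0 := by
  have hnn : ∀ x, 0 ≤ valueAt u x ⬝ᵥ valueAt u x := fun x =>
    Finset.sum_nonneg fun l _ => mul_self_nonneg _
  have hae := (setIntegral_eq_zero_iff_of_nonneg_ae (Eventually.of_forall hnn)
    ((continuous_dot u u).continuousOn.integrableOn_compact hK)).1 h
  have hae' : (fun x => valueAt u x ⬝ᵥ valueAt u x) =ᵐ[volume.restrict (interior K)]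
      fun _ => (0 : ℝ) := ae_restrict_of_ae_restrict_of_subset interior_subset hae
  have hz : EqOn (fun x => valueAt u x ⬝ᵥ valueAt u x) (fun _ => (0 : ℝ)) (interior K) :=
    Measure.eqOn_open_of_ae_eq hae' isOpen_interior (continuous_dot u u).continuousOn
      continuousOn_const
  obtain ⟨x₀, hx₀⟩ := hi
  have hn : (fun y : Fin 2 → ℝ => (WithLp.toLp 2 y : Pt)) ⁻¹' interior K ∈ 𝓝 (fun i => x₀ i) := by
    apply (isOpen_interior.preimage (by fun_prop)).mem_nhds
    simpa using hx₀
  obtain ⟨r, hr, hb⟩ := Metric.mem_nhds_iff.1 hn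
  funext l
  refine MvPolynomial.funext_set (fun i => Metric.ball (x₀ i) r) (fun i => ?_) fun y hy => ?_
  · rw [Real.ball_eq_Ioo]
    exact Ioo_infinite (by linarith)
  · have hy' : y ∈ Metric.ball (fun i => x₀ i) r := by
      rw [ball_pi _ hr]; exact hy
    have h0 : valueAt u (WithLp.toLp 2 y) ⬝ᵥ valueAt u (WithLp.toLp 2 y) = 0 := hz (hb hy')
    have h1 := congrFun (dotProduct_self_eq_zero.1 h0) l
    simpa [valueAt, pval] using h1

/-- Riesz representation on the local space with the `L²` product of a cell. -/
theorem existsUnique_riesz {K : Set Pt} (hK : IsCompact K) (hi : (interior K).Nonempty) (k : ℕ)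
    (φ : PolyVec →ₗ[ℝ] ℝ) :
    ∃! L : PolyVec, L ∈ localSpace k ∧
      ∀ u ∈ localSpace k, ∫ x in K, valueAt L x ⬝ᵥ valueAt u x = φ u := by
  have hint : ∀ u v : PolyVec, IntegrableOn (fun x => valueAt u x ⬝ᵥ valueAt v x) K := fun u v =>
    (continuous_dot u v).continuousOn.integrableOn_compact hK
  let b : PolyVec →ₗ[ℝ] PolyVec →ₗ[ℝ] ℝ := LinearMap.mk₂ ℝ
    (fun u v => ∫ x in K, valueAt u x ⬝ᵥ valueAt v x)
    (fun u v w => by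
      simp only [valueAt_add, add_dotProduct]; exact integral_add (hint u w) (hint v w))
    (fun c u v => by
      simp only [valueAt_smul, smul_dotProduct, smul_eq_mul]; exact integral_const_mul _ _)
    (fun u v w => by
      simp only [valueAt_add, dotProduct_add]; exact integral_add (hint u v) (hint u w))
    (fun c u v => by
      simp only [valueAt_smul, dotProduct_smul, smul_eq_mul]; exact integral_const_mul _ _)
  have hb : ∀ u v, b u v = ∫ x in K, valueAt u x ⬝ᵥ valueAt v x := fun u v => rfl
  have hle : localSpace k ≤
      Submodule.pi Set.univ (fun _ : Fin 8 => MvPolynomial.restrictTotalDegree (Fin 2) ℝ k) :=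
    fun u hu l _ => hu.1 l
  have : Module.Finite ℝ (Submodule.pi Set.univ
      (fun _ : Fin 8 => MvPolynomial.restrictTotalDegree (Fin 2) ℝ k)) := by
    let f : (Submodule.pi Set.univ
        (fun _ : Fin 8 => MvPolynomial.restrictTotalDegree (Fin 2) ℝ k)) →ₗ[ℝ]
        (Fin 8 → MvPolynomial.restrictTotalDegree (Fin 2) ℝ k) :=
      { toFun := fun u l => ⟨u.1 l, u.2 l trivial⟩
        map_add' := fun u v => rfl
        map_smul' := fun c u => rfl }
    refine Module.Finite.of_injective f fun u v h => ?_
    ext1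
    funext l
    exact congrArg Subtype.val (congrFun h l)
  have : Module.Finite ℝ (localSpace k) :=
    Module.Finite.of_injective _ (Submodule.inclusion_injective hle)
  let T : localSpace k →ₗ[ℝ] Module.Dual ℝ (localSpace k) :=
    (b.domRestrict₁₂ (localSpace k) (localSpace k))
  have hT : ∀ u v : localSpace k, T u v = ∫ x in K, valueAt u.1 x ⬝ᵥ valueAt v.1 x :=
    fun u v => rfl
  have hinj : Function.Injective T := by
    rw [← LinearMap.ker_eq_bot, LinearMap.ker_eq_bot']
    intro u hu
    have : T u u = 0 := by rw [hu]; rfl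
    exact Subtype.ext (eq_zero_of_integral_eq_zero hK hi u.1 (by rw [← hT]; exact this))
  have hsurj : Function.Surjective T :=
    (LinearMap.injective_iff_surjective_of_finrank_eq_finrank
      Subspace.dual_finrank_eq.symm).1 hinj
  obtain ⟨L, hL⟩ := hsurj (φ.comp (localSpace k).subtype)
  refine ⟨L.1, ⟨L.2, fun u hu => ?_⟩, ?_⟩
  · rw [← hT L ⟨u, hu⟩, hL]; rfl
  · rintro L' ⟨hL', hu'⟩
    have : T ⟨L', hL'⟩ = T L := by
      rw [hL]
      ext u
      exact hu' u.1 u.2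
    exact congrArg Subtype.val (hinj this)

section Operator

variable {ι ε : Type*} (H : ℝ → ℝ → ℝ) (M : PolygonalMesh ι ε) {k Q : ℕ}
  (R : EdgeQuadrature k Q) (C : ∀ K, CellQuadrature k (M.cell K)) (g : ε → Fin Q → State)

/-- The weak formulation has exactly one solution on each cell. -/
theorem existsUnique_dgOperator (U : ι → PolyVec) (K : ι) :
    ∃! L : PolyVec, L ∈ localSpace k ∧
      ∀ u ∈ localSpace k,
        ∫ x in M.cell K, valueAt L x ⬝ᵥ valueAt u x = rhs H M R C g U K u :=
  existsUnique_riesz (M.isCompact_cell K) (M.isConnected_interior K).nonempty k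
    { toFun := rhs H M R C g U K
      map_add' := rhs_add H M R C g U K
      map_smul' := rhs_smul H M R C g U K }

/-- The operator `L_h` of the semi-discrete scheme `d/dt U_h = L_h(U_h)`: the unique element of
`W_h^k` with `∫_K L_h(U_h) · u = J_K(U_h, u)` for all cells `K` and all `u ∈ W_h^k`. -/
noncomputable def dgOperator (U : ι → PolyVec) : ι → PolyVec :=
  fun K => (existsUnique_dgOperator H M R C g U K).choose

theorem dgOperator_spec (U : ι → PolyVec) (K : ι) :
    dgOperator H M R C g U K ∈ localSpace k ∧
      ∀ u ∈ localSpace k,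
        ∫ x in M.cell K, valueAt (dgOperator H M R C g U K) x ⬝ᵥ valueAt u x
          = rhs H M R C g U K u :=
  (existsUnique_dgOperator H M R C g U K).choose_spec.1

/-- The cell average. -/
noncomputable def cellAverage (U : ι → PolyVec) (K : ι) : State :=
  fun l => (M.area K)⁻¹ * ∫ x in M.cell K, pval (U K l) x

/-- The functions of `W_h^k` all of whose cell averages are admissible. -/
def admissibleAverages (k : ℕ) : Set (ι → PolyVec) :=
  {U | U ∈ dgSpace ι k ∧ ∀ K, cellAverage M U K ∈ admissible H}

/-- The critical points of a cell: the edge quadrature points, the other points of the special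
quadrature, and the points of the quadrature for the element integral. -/
def criticalPoints (P : ∀ K, SpecialQuadrature M R K) (K : ι) : Set Pt :=
  {x | ∃ e ∈ M.edges K, ∃ q, x = M.edgePoint e (R.node q)} ∪ range (P K).node
    ∪ range (C K).node

/-- The functions with admissible cell averages and admissible values at the critical points. -/
def admissiblePointwise (P : ∀ K, SpecialQuadrature M R K) : Set (ι → PolyVec) :=
  {U | U ∈ admissibleAverages H M k ∧
    ∀ K, ∀ x ∈ criticalPoints M R C P K, valueAt (U K) x ∈ admissible H}

/-- The quantity `σ_{K,E,q}(U_h)`, half the jump of the normal magnetic field over `√(ρ H)`. -/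
noncomputable def jumpSpeed (U : ι → PolyVec) (K : ι) (e : ε) (q : Fin Q) : ℝ :=
  (1 / 2) * |normalB (M.normal K e) (intState M R U K e q)
      - normalB (M.normal K e) (extState M R g U K e q)|
    / √((prim H (intState M R U K e q)).ρ * (prim H (intState M R U K e q)).enthalpy H)

end Operator

end RMHD

namespace RMHD

/-! ### Gram inequalities for three-dimensional vectors -/

/-! Admissibility is defined through primitive variables, which are only implicit functions of the
state. The proof replaces it by linear conditions: `U` is admissible exactly when `U 0 > 0` and
`A(U) := U ⬝ᵥ dualState u b + magPressure u b` is positive for every `b` and every subluminal `u`.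
Necessity (`Prim.IsPhysical.dot_dualState_pos`) comes from splitting `A(U)` into a hydrodynamic part
and two nonnegative magnetic forms. Sufficiency (`mem_admissible_of_dot_dualState_pos`) recovers the
primitive variables from a root of a scalar equation (`exists_enthalpy_root`). For fixed `u`, `b`
the condition is affine in `U`, hence compatible with quadrature averages.

Two estimates control the scheme, with `ξ = dualState u b` and `p_m = magPressure u b`. The normal
flux satisfies `⟨n, F(U)⟩ · ξ ≤ A(U) - (n · u) p_m + (n · B)(u · b)` (`normalFlux_dot_le`), and the
source satisfies `|S · ξ + u · b| ≤ A(U) / √(ρH)` (`Prim.IsPhysical.abs_source_dot_le`). In an edge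
term, the source times half the jump of `n · B` turns the mean of the interior and exterior `n · B`
into the interior value, at the cost `σ A(U_int)` (`edgeTerm_dot_le`).

Testing the scheme with constants gives the Euler step of a cell average, and the special quadrature
writes the old average as a convex combination of point values (`cellAverage_step`). The CFL
condition makes the coefficient of each `A(U_int)` positive. The remainder is a multiple of `∑ |E| ω
((n · u) p_m - (n · B_int)(u · b))`. It vanishes because the weighted normals of a cell sum to zero
and because `B_int` is divergence-free on the cell and integrated exactly on the edges
(`sum_edges_normal_const`, `sum_edges_normalB`). Both facts rest on the divergence theorem on a
polygon, `PolygonalMesh.integral_pderiv`, proved by slicing with lines. -/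

theorem dot_eq (x y : Vec3) : x ⬝ᵥ y = x 0 * y 0 + x 1 * y 1 + x 2 * y 2 := by
  simp [dotProduct, Fin.sum_univ_three]

theorem dot_self_nonneg (x : Vec3) : 0 ≤ x ⬝ᵥ x := by
  rw [dot_eq]
  linarith [mul_self_nonneg (x 0), mul_self_nonneg (x 1), mul_self_nonneg (x 2)]

theorem gram_two (x y : Vec3) : (x ⬝ᵥ y) ^ 2 ≤ x ⬝ᵥ x * y ⬝ᵥ y := by
  simp only [dot_eq]
  linarith [sq_nonneg (x 0 * y 1 - x 1 * y 0), sq_nonneg (x 0 * y 2 - x 2 * y 0),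
    sq_nonneg (x 1 * y 2 - x 2 * y 1)]

/-- The Gram determinant of three vectors is nonnegative. -/
theorem gram_three (x y z : Vec3) :
    0 ≤ x ⬝ᵥ x * (y ⬝ᵥ y * z ⬝ᵥ z - (y ⬝ᵥ z) ^ 2)
      - x ⬝ᵥ y * (x ⬝ᵥ y * z ⬝ᵥ z - y ⬝ᵥ z * x ⬝ᵥ z)
      + x ⬝ᵥ z * (x ⬝ᵥ y * y ⬝ᵥ z - y ⬝ᵥ y * x ⬝ᵥ z) := by
  have h := sq_nonneg (x 0 * (y 1 * z 2 - y 2 * z 1) - x 1 * (y 0 * z 2 - y 2 * z 0)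
    + x 2 * (y 0 * z 1 - y 1 * z 0))
  simp only [dot_eq]
  linarith

/-- The Gram determinant of four vectors vanishes. -/
theorem gram_four (x y z n : Vec3) :
    n ⬝ᵥ n * (x ⬝ᵥ x * (y ⬝ᵥ y * z ⬝ᵥ z - (y ⬝ᵥ z) ^ 2)
      - x ⬝ᵥ y * (x ⬝ᵥ y * z ⬝ᵥ z - y ⬝ᵥ z * x ⬝ᵥ z)
      + x ⬝ᵥ z * (x ⬝ᵥ y * y ⬝ᵥ z - y ⬝ᵥ y * x ⬝ᵥ z))
    = (n ⬝ᵥ x) ^ 2 * (y ⬝ᵥ y * z ⬝ᵥ z - (y ⬝ᵥ z) ^ 2)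
      + (n ⬝ᵥ y) ^ 2 * (x ⬝ᵥ x * z ⬝ᵥ z - (x ⬝ᵥ z) ^ 2)
      + (n ⬝ᵥ z) ^ 2 * (x ⬝ᵥ x * y ⬝ᵥ y - (x ⬝ᵥ y) ^ 2)
      + 2 * (n ⬝ᵥ x * n ⬝ᵥ y * (x ⬝ᵥ z * y ⬝ᵥ z - x ⬝ᵥ y * z ⬝ᵥ z))
      + 2 * (n ⬝ᵥ x * n ⬝ᵥ z * (x ⬝ᵥ y * y ⬝ᵥ z - x ⬝ᵥ z * y ⬝ᵥ y))
      + 2 * (n ⬝ᵥ y * n ⬝ᵥ z * (x ⬝ᵥ y * x ⬝ᵥ z - x ⬝ᵥ x * y ⬝ᵥ z)) := by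
  simp only [dot_eq]
  ring

/-- The positive semidefinite form `(1 - |u|²) |x|² + (u · x)²` of a subluminal velocity. -/
theorem boost_form_nonneg {u : Vec3} (hu : u ⬝ᵥ u < 1) (x : Vec3) :
    0 ≤ (1 - u ⬝ᵥ u) * x ⬝ᵥ x + (u ⬝ᵥ x) ^ 2 := by
  have := mul_nonneg (sub_nonneg.2 hu.le) (dot_self_nonneg x)
  positivity

/-- Cauchy-Schwarz for the form `(1 - |u|²) |x|² + (u · x)²`. -/
theorem boost_form_cauchy {u : Vec3} (hu : u ⬝ᵥ u < 1) (x y : Vec3) :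
    ((1 - u ⬝ᵥ u) * x ⬝ᵥ y + u ⬝ᵥ x * u ⬝ᵥ y) ^ 2
      ≤ ((1 - u ⬝ᵥ u) * x ⬝ᵥ x + (u ⬝ᵥ x) ^ 2) * ((1 - u ⬝ᵥ u) * y ⬝ᵥ y + (u ⬝ᵥ y) ^ 2) := by
  -- The defect in the inequality is `(1 - |u|²)² (|x|²|y|² - (x·y)²) + (1 - |u|²) |(u·y) x - (u·x)
  -- y|²`.
  have h1 := mul_nonneg (sq_nonneg (1 - u ⬝ᵥ u)) (sub_nonneg.2 (gram_two x y))
  have h2 := mul_nonneg (sub_nonneg.2 hu.le)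
    (dot_self_nonneg ((u ⬝ᵥ y) • x - (u ⬝ᵥ x) • y))
  have h3 : ((u ⬝ᵥ y) • x - (u ⬝ᵥ x) • y) ⬝ᵥ ((u ⬝ᵥ y) • x - (u ⬝ᵥ x) • y)
      = (u ⬝ᵥ y) ^ 2 * x ⬝ᵥ x - 2 * (u ⬝ᵥ x * u ⬝ᵥ y * x ⬝ᵥ y) + (u ⬝ᵥ x) ^ 2 * y ⬝ᵥ y := by
    simp only [sub_dotProduct, dotProduct_sub, smul_dotProduct, dotProduct_smul, smul_eq_mul,
      dotProduct_comm y x]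
    ring
  rw [h3] at h2
  linarith

/-- Cauchy-Schwarz for `(√a, √b)` and `(√P, √Q)` without square roots; it merges bounds for two
summands into one bound for their sum. -/
theorem add_sq_le_of_sq_le {x y a b P Q : ℝ} (ha : 0 ≤ a) (hb : 0 ≤ b) (hP : 0 ≤ P)
    (hQ : 0 ≤ Q) (hx : x ^ 2 ≤ a * P) (hy : y ^ 2 ≤ b * Q) :
    (x + y) ^ 2 ≤ (a + b) * (P + Q) := by
  have h : 2 * (x * y) ≤ a * Q + b * P := by
    refine le_of_sq_le_sq ?_ (by positivity)
    have := mul_le_mul hx hy (sq_nonneg y) (mul_nonneg ha hP)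
    linarith [sq_nonneg (a * Q - b * P)]
  linarith

/-! ### Lorentz factor and enthalpy -/

theorem Prim.W_sq_mul {w : Prim} (hv : w.v ⬝ᵥ w.v < 1) : w.W ^ 2 * (1 - w.v ⬝ᵥ w.v) = 1 := by
  have h : 0 < 1 - w.v ⬝ᵥ w.v := sub_pos.2 hv
  rw [Prim.W, div_pow, Real.sq_sqrt h.le]
  field_simp

theorem Prim.W_pos {w : Prim} (hv : w.v ⬝ᵥ w.v < 1) : 0 < w.W := by
  have h : 0 < 1 - w.v ⬝ᵥ w.v := sub_pos.2 hv
  unfold Prim.W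
  positivity

theorem Prim.ptot_eq {w : Prim} (hv : w.v ⬝ᵥ w.v < 1) :
    w.ptot = w.p + 1 / 2 * ((1 - w.v ⬝ᵥ w.v) * w.B ⬝ᵥ w.B + (w.v ⬝ᵥ w.B) ^ 2) := by
  have h := W_sq_mul hv
  have h' : w.B ⬝ᵥ w.B / w.W ^ 2 = (1 - w.v ⬝ᵥ w.v) * w.B ⬝ᵥ w.B := by
    rw [div_eq_iff (pow_pos (W_pos hv) 2).ne']
    linear_combination -(w.B ⬝ᵥ w.B) * h
  rw [ptot, h']

/-- The kinetic lower bound, in terms of the enthalpy density `ρ H`. -/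
theorem CausalEOS.kinetic_density {H : ℝ → ℝ → ℝ} (hH : CausalEOS H) {p ρ : ℝ} (hp : 0 < p)
    (hρ : 0 < ρ) : √(ρ ^ 2 + p ^ 2) + p ≤ ρ * H p ρ := by
  have h := mul_le_mul_of_nonneg_left (hH.kinetic p ρ hp hρ) hρ.le
  have h1 : ρ * √(1 + p ^ 2 / ρ ^ 2) = √(ρ ^ 2 + p ^ 2) := by
    rw [← Real.sqrt_sq hρ.le, ← Real.sqrt_mul (sq_nonneg ρ), Real.sqrt_sq hρ.le]
    congr 1
    field_simp
  have h2 : ρ * (p / ρ) = p := by field_simp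
  rwa [mul_add, h1, h2] at h

/-! ### Linear functionals that characterize admissible states -/

/-- The direction `ξ` that depends on a subluminal velocity `u` and a magnetic field `b`. -/
noncomputable def dualState (u b : Vec3) : State :=
  mkState (-√(1 - u ⬝ᵥ u)) (-u) (-((1 - u ⬝ᵥ u) • b + (u ⬝ᵥ b) • u)) 1

/-- The magnetic pressure of the velocity `u` and the field `b`. -/
noncomputable def magPressure (u b : Vec3) : ℝ :=
  1 / 2 * ((1 - u ⬝ᵥ u) * b ⬝ᵥ b + (u ⬝ᵥ b) ^ 2)

theorem mkState_dot (a a' e e' : ℝ) (m m' b b' : Vec3) :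
    mkState a m b e ⬝ᵥ mkState a' m' b' e' = a * a' + m ⬝ᵥ m' + b ⬝ᵥ b' + e * e' := by
  simp [mkState, dotProduct, Fin.sum_univ_succ]
  ring

/-- The pairing of a state with a dual state, split into hydrodynamic and magnetic parts. -/
theorem cons_dot_dualState (H : ℝ → ℝ → ℝ) {w : Prim} (hv : w.v ⬝ᵥ w.v < 1) (u b : Vec3) :
    w.cons H ⬝ᵥ dualState u b + magPressure u b
      = (w.ρ * w.enthalpy H * w.W ^ 2 * (1 - w.v ⬝ᵥ u) - w.p - w.ρ * w.W * √(1 - u ⬝ᵥ u))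
        + 1 / 2 * ((1 - u ⬝ᵥ u) * (b - w.B) ⬝ᵥ (b - w.B) + (u ⬝ᵥ (b - w.B)) ^ 2)
        + 1 / 2 * (w.B ⬝ᵥ w.B * (u - w.v) ⬝ᵥ (u - w.v) - (w.B ⬝ᵥ (u - w.v)) ^ 2) := by
  simp only [Prim.cons, dualState, magPressure, mkState_dot, Prim.momentum, Prim.ptot_eq hv,
    sub_dotProduct, dotProduct_sub, smul_dotProduct, dotProduct_smul, smul_eq_mul,
    dotProduct_neg, dotProduct_add, dotProduct_comm w.B w.v, dotProduct_comm w.B u,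
    dotProduct_comm u w.v, dotProduct_comm b w.B]
  ring

/-- Adding `u · b` makes everything vanish at `u = v`. The first bracket is `(v × u) · (B × (u -
v))` and the second is the boost form at `u - v` and `b - B`, so each yields to Cauchy-Schwarz. -/
theorem source_dot_dualState (w : Prim) (u b : Vec3) :
    w.source ⬝ᵥ dualState u b + u ⬝ᵥ b
      = (w.v ⬝ᵥ w.B * u ⬝ᵥ (u - w.v) - w.v ⬝ᵥ (u - w.v) * u ⬝ᵥ w.B)
        + ((1 - u ⬝ᵥ u) * (u - w.v) ⬝ᵥ (b - w.B) + u ⬝ᵥ (u - w.v) * u ⬝ᵥ (b - w.B)) := by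
  simp only [Prim.source, dualState, mkState_dot, Prim.inducedField, add_dotProduct,
    sub_dotProduct, dotProduct_sub, smul_dotProduct, dotProduct_smul, smul_eq_mul,
    dotProduct_neg, dotProduct_add, dotProduct_comm w.B u, dotProduct_comm u w.v]
  ring

/-- The hydrodynamic part is positive. -/
theorem hydro_pos {h p ρ W vv uu uv : ℝ} (hp : 0 < p) (hρ : 0 < ρ) (hW : 0 < W)
    (hWv : W ^ 2 * (1 - vv) = 1) (hu : uu < 1) (hC : uv ^ 2 ≤ vv * uu)
    (hh : √(ρ ^ 2 + p ^ 2) + p ≤ h) (hvv : 0 ≤ vv) (huu : 0 ≤ uu) :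
    0 < h * W ^ 2 * (1 - uv) - p - ρ * W * √(1 - uu) := by
  set s := √(ρ ^ 2 + p ^ 2) with hs
  have hs2 : s ^ 2 = ρ ^ 2 + p ^ 2 := Real.sq_sqrt (by positivity)
  have hsp : 0 < s := Real.sqrt_pos.2 (by positivity)
  set r := √(1 - uu) with hr
  have hr2 : r ^ 2 = 1 - uu := Real.sq_sqrt (by linarith)
  have hr0 : 0 ≤ r := Real.sqrt_nonneg _
  have hh0 : 0 < h := by linarith
  have hW1 : 1 ≤ W ^ 2 := by nlinarith [sq_nonneg W]
  have hps : p < s := by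
    rw [hs]; exact Real.lt_sqrt_of_sq_lt (by nlinarith)
  -- Cauchy-Schwarz against `(u, r)`, which is a unit vector: `|u|² + r² = 1`.
  have key : (h * W ^ 2 * uv + ρ * W * r) ^ 2 ≤ (h * W ^ 2) ^ 2 * vv + (ρ * W) ^ 2 := by
    have h1 := add_sq_le_of_sq_le (x := h * W ^ 2 * uv) (y := ρ * W * r)
      (a := (h * W ^ 2) ^ 2 * vv) (b := (ρ * W) ^ 2) (P := uu) (Q := r ^ 2) (by positivity)
      (by positivity) huu (sq_nonneg r)
      (by nlinarith [mul_le_mul_of_nonneg_left hC (sq_nonneg (h * W ^ 2))])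
      (by rw [mul_pow])
    rw [hr2] at h1
    linarith
  have hT : (h * W ^ 2) ^ 2 * vv = (h * W ^ 2) ^ 2 - h ^ 2 * W ^ 2 := by
    linear_combination (-(h ^ 2 * W ^ 2)) * hWv
  have hhp : s ^ 2 ≤ (h - p) ^ 2 := pow_le_pow_left₀ hsp.le (by linarith) 2
  -- The square on the right exceeds the bound in `key` by `W² ((h - p)² - s²) + p²`.
  have h2 : (h * W ^ 2 * uv + ρ * W * r) ^ 2 < (h * W ^ 2 - p) ^ 2 := by
    have := mul_nonneg (sq_nonneg W) (sub_nonneg.2 hhp)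
    nlinarith
  have h3 : h * W ^ 2 * uv + ρ * W * r < h * W ^ 2 - p := by
    refine lt_of_pow_lt_pow_left₀ 2 ?_ h2
    nlinarith
  linarith

/-- The hydrodynamic part dominates half the enthalpy density times the squared velocity
difference. -/
theorem hydro_ge {h p ρ W vv uu uv : ℝ} (hp : 0 < p) (hρ : 0 < ρ)
    (hWv : W ^ 2 * (1 - vv) = 1) (hu : uu < 1)
    (hh : √(ρ ^ 2 + p ^ 2) + p ≤ h) (hvv : 0 ≤ vv) (hd : 0 ≤ vv + uu - 2 * uv) :
    1 / 2 * h * (vv + uu - 2 * uv) ≤ h * W ^ 2 * (1 - uv) - p - ρ * W * √(1 - uu) := by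
  set s := √(ρ ^ 2 + p ^ 2) with hs
  have hs2 : s ^ 2 = ρ ^ 2 + p ^ 2 := Real.sq_sqrt (by positivity)
  have hsp : 0 < s := Real.sqrt_pos.2 (by positivity)
  set r := √(1 - uu) with hr
  have hr2 : r ^ 2 = 1 - uu := Real.sq_sqrt (by linarith)
  have hh0 : 0 < h := by linarith
  have hW1 : 1 ≤ W ^ 2 := by nlinarith [sq_nonneg W]
  have hhp : s ^ 2 ≤ (h - p) ^ 2 := pow_le_pow_left₀ hsp.le (by linarith) 2
  -- Young's inequality for the product of `ρ` and `h W r`, with `ρ² ≤ h² - 2hp` from the kinetic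
  -- bound.
  have h1 : h * (2 * (ρ * W * r)) ≤ h * (h - 2 * p + h * W ^ 2 * (1 - uu)) := by
    have := sq_nonneg (ρ - h * W * r)
    have e : (ρ - h * W * r) ^ 2 = ρ ^ 2 - h * (2 * (ρ * W * r)) + h ^ 2 * W ^ 2 * (1 - uu) := by
      rw [← hr2]; ring
    nlinarith
  have h2 := le_of_mul_le_mul_left h1 hh0
  -- Since `h = h W² (1 - |v|²)`, what remains is `½ h W² |u - v|²`, and `W² ≥ 1`.
  have h3 := mul_le_mul_of_nonneg_left hW1 (mul_nonneg hh0.le hd)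
  nlinarith

theorem Prim.IsPhysical.kinetic {H : ℝ → ℝ → ℝ} (hH : CausalEOS H) {w : Prim}
    (hw : w.IsPhysical H) : √(w.ρ ^ 2 + w.p ^ 2) + w.p ≤ w.ρ * w.enthalpy H :=
  hH.kinetic_density hw.2.1 hw.1

theorem Prim.IsPhysical.enthalpyDensity_pos {H : ℝ → ℝ → ℝ} (hH : CausalEOS H) {w : Prim}
    (hw : w.IsPhysical H) : 0 < w.ρ * w.enthalpy H :=
  (add_pos_of_nonneg_of_pos (Real.sqrt_nonneg _) hw.2.1).trans_le (hw.kinetic hH)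

/-- Physical states pair positively with all dual states. -/
theorem Prim.IsPhysical.dot_dualState_pos {H : ℝ → ℝ → ℝ} (hH : CausalEOS H) {w : Prim}
    (hw : w.IsPhysical H) {u : Vec3} (hu : u ⬝ᵥ u < 1) (b : Vec3) :
    0 < w.cons H ⬝ᵥ dualState u b + magPressure u b := by
  obtain ⟨hρ, hp, -, hv⟩ := id hw
  rw [cons_dot_dualState H hv]
  have h1 := hydro_pos hp hρ (W_pos hv) (W_sq_mul hv) hu (gram_two w.v u) (hw.kinetic hH)
    (dot_self_nonneg _) (dot_self_nonneg _)
  have h2 := boost_form_nonneg hu (b - w.B)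
  have h3 := gram_two w.B (u - w.v)
  linarith

/-- The source term is controlled by the pairing with the dual state. -/
theorem Prim.IsPhysical.abs_source_dot_le {H : ℝ → ℝ → ℝ} (hH : CausalEOS H) {w : Prim}
    (hw : w.IsPhysical H) {u : Vec3} (hu : u ⬝ᵥ u < 1) (b : Vec3) :
    |w.source ⬝ᵥ dualState u b + u ⬝ᵥ b|
      ≤ (w.cons H ⬝ᵥ dualState u b + magPressure u b) / √(w.ρ * w.enthalpy H) := by
  obtain ⟨hρ, hp, -, hv⟩ := id hw
  have hh := hw.enthalpyDensity_pos hH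
  have hA := hw.dot_dualState_pos hH hu b
  have hd : (u - w.v) ⬝ᵥ (u - w.v) = w.v ⬝ᵥ w.v + u ⬝ᵥ u - 2 * w.v ⬝ᵥ u := by
    simp only [sub_dotProduct, dotProduct_sub, dotProduct_comm u w.v]
    ring
  have hhyd := hydro_ge (uv := w.v ⬝ᵥ u) hp hρ (W_sq_mul hv) hu (hw.kinetic hH)
    (dot_self_nonneg _) (hd ▸ dot_self_nonneg _)
  have hQ := boost_form_nonneg hu (b - w.B)
  have hP := gram_two w.B (u - w.v)
  have hβ := boost_form_cauchy hu (u - w.v) (b - w.B)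
  -- Binet-Cauchy: the left side is the square of `(v × u) · (B × (u - v))`, and `|v × u| = |u × (u
  -- - v)|`.
  have hα : (w.v ⬝ᵥ w.B * u ⬝ᵥ (u - w.v) - w.v ⬝ᵥ (u - w.v) * u ⬝ᵥ w.B) ^ 2
      ≤ (u ⬝ᵥ u * (u - w.v) ⬝ᵥ (u - w.v) - (u ⬝ᵥ (u - w.v)) ^ 2)
        * (w.B ⬝ᵥ w.B * (u - w.v) ⬝ᵥ (u - w.v) - (w.B ⬝ᵥ (u - w.v)) ^ 2) := by
    have := gram_two (crossProduct w.v u) (crossProduct w.B (u - w.v))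
    simp only [cross_dot_cross, dotProduct_comm u w.v] at this ⊢
    refine this.trans (le_of_eq ?_)
    simp only [sub_dotProduct, dotProduct_sub, dotProduct_comm u w.v, dotProduct_comm w.B w.v,
      dotProduct_comm w.B u]
    ring
  have hX := add_sq_le_of_sq_le (sub_nonneg.2 (gram_two u (u - w.v)))
    (boost_form_nonneg hu (u - w.v)) (sub_nonneg.2 hP) hQ hα hβ
  rw [← source_dot_dualState, show u ⬝ᵥ u * (u - w.v) ⬝ᵥ (u - w.v) - (u ⬝ᵥ (u - w.v)) ^ 2
    + ((1 - u ⬝ᵥ u) * (u - w.v) ⬝ᵥ (u - w.v) + (u ⬝ᵥ (u - w.v)) ^ 2)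
    = (u - w.v) ⬝ᵥ (u - w.v) by ring] at hX
  rw [le_div_iff₀ (Real.sqrt_pos.2 hh)]
  refine le_of_sq_le_sq ?_ hA.le
  rw [mul_pow, sq_abs, Real.sq_sqrt hh.le]
  rw [cons_dot_dualState H hv]
  rw [← hd] at hhyd
  set N := w.B ⬝ᵥ w.B * (u - w.v) ⬝ᵥ (u - w.v) - (w.B ⬝ᵥ (u - w.v)) ^ 2
    + ((1 - u ⬝ᵥ u) * (b - w.B) ⬝ᵥ (b - w.B) + (u ⬝ᵥ (b - w.B)) ^ 2) with hN
  have hN0 : 0 ≤ N := by linarith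
  have hd0 := dot_self_nonneg (u - w.v)
  -- Arithmetic-geometric mean for `ρH |u - v|²` and `N`; by `hydro_ge` the pairing dominates half
  -- their sum.
  calc _ ≤ (u - w.v) ⬝ᵥ (u - w.v) * N * (w.ρ * w.enthalpy H) :=
        mul_le_mul_of_nonneg_right hX hh.le
    _ ≤ (1 / 2 * (w.ρ * w.enthalpy H) * (u - w.v) ⬝ᵥ (u - w.v) + 1 / 2 * N) ^ 2 := by
        linarith [sq_nonneg (1 / 2 * (w.ρ * w.enthalpy H) * (u - w.v) ⬝ᵥ (u - w.v) - 1 / 2 * N)]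
    _ ≤ _ := by
        refine pow_le_pow_left₀ (by positivity) ?_ 2
        linarith

/-! ### The Lax-Friedrichs splitting inequality -/

/-- A vector of the plane as a vector of `ℝ³`. -/
def liftVec (n : Pt) : Vec3 := ![n 0, n 1, 0]

theorem liftVec_dot (n : Pt) (x : Vec3) : liftVec n ⬝ᵥ x = n 0 * x 0 + n 1 * x 1 := by
  rw [dot_eq]
  simp [liftVec]

theorem liftVec_dot_self (n : Pt) : liftVec n ⬝ᵥ liftVec n = ‖n‖ ^ 2 := by
  rw [liftVec_dot, EuclideanSpace.norm_sq_eq, Fin.sum_univ_two]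
  simp [liftVec]
  ring

/-- The terms proportional to `n · B` assemble into the source pairing. Once the pairings are
expanded, the right side separates into the expressions of `hydro_flux_nonneg` and
`magnetic_flux_nonneg`. -/
theorem sum_flux_dot_dualState (H : ℝ → ℝ → ℝ) {w : Prim} (hv : w.v ⬝ᵥ w.v < 1) (u b : Vec3)
    (n : Pt) :
    (w.cons H - ∑ i : Fin 2, n i • w.flux H i) ⬝ᵥ dualState u b + magPressure u b
        - (liftVec n ⬝ᵥ u * magPressure u b - liftVec n ⬝ᵥ w.B * u ⬝ᵥ b)
      = (1 - liftVec n ⬝ᵥ w.v) * (w.cons H ⬝ᵥ dualState u b + magPressure u b)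
        + (liftVec n ⬝ᵥ u - liftVec n ⬝ᵥ w.v) * (w.ptot - magPressure u b)
        + liftVec n ⬝ᵥ w.B * (w.source ⬝ᵥ dualState u b + u ⬝ᵥ b) := by
  have e0 : (0 : Fin 2).castSucc = (0 : Fin 3) := rfl
  have e1 : (1 : Fin 2).castSucc = (1 : Fin 3) := rfl
  have hm : w.momentum H 0 * n 0 + w.momentum H 1 * n 1
      = (w.ρ * w.enthalpy H * w.W ^ 2 + w.B ⬝ᵥ w.B) * liftVec n ⬝ᵥ w.v
        - w.v ⬝ᵥ w.B * liftVec n ⬝ᵥ w.B := by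
    simp only [Prim.momentum, liftVec_dot, Pi.sub_apply, Pi.smul_apply, smul_eq_mul]
    ring
  simp only [sub_dotProduct, Fin.sum_univ_two, add_dotProduct, smul_dotProduct, Prim.cons,
    Prim.flux, Prim.source, dualState, mkState_dot, e0, e1, dotProduct_neg,
    single_dotProduct, smul_eq_mul, one_mul, mul_one]
  generalize w.momentum H = m at *
  have hE : w.ptot = w.p + 1 / 2 * ((1 - w.v ⬝ᵥ w.v) * w.B ⬝ᵥ w.B + (w.v ⬝ᵥ w.B) ^ 2) :=
    Prim.ptot_eq hv
  simp only [liftVec_dot] at hm ⊢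
  simp only [dotProduct_add, dotProduct_smul, smul_eq_mul]
  linear_combination -hm

/-- The light-like direction `(1, -n)` pairs nonnegatively with the hydrodynamic part. -/
theorem hydro_flux_nonneg {h p ρ W vv uu uv vn un : ℝ} (hp : 0 < p) (hρ : 0 < ρ) (hW : 0 < W)
    (hWv : W ^ 2 * (1 - vv) = 1) (hu : uu < 1)
    (hh : √(ρ ^ 2 + p ^ 2) + p ≤ h) (hvn : vn < 1) (huv : uv < 1)
    (hG : (1 - un) ^ 2 * (1 - vv) + (1 - uu) * (1 - vn) ^ 2
      ≤ 2 * (1 - uv) * (1 - vn) * (1 - un)) :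
    0 ≤ (1 - vn) * (h * W ^ 2 * (1 - uv) - p - ρ * W * √(1 - uu)) + (un - vn) * p := by
  set s := √(ρ ^ 2 + p ^ 2) with hs
  have hs2 : s ^ 2 = ρ ^ 2 + p ^ 2 := Real.sq_sqrt (by positivity)
  have hsp : 0 < s := Real.sqrt_pos.2 (by positivity)
  set r := √(1 - uu) with hr
  have hr2 : r ^ 2 = 1 - uu := Real.sq_sqrt (by linarith)
  set a := W ^ 2 * (1 - uv) * (1 - vn) with ha
  have ha0 : 0 ≤ a := mul_nonneg (mul_nonneg (sq_nonneg W) (by linarith)) (by linarith)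
  set d := W * r * (1 - vn) with hd
  -- Multiplied by `W²`, `hG` says that `(1 - un - a, d)` has norm at most `a`. Pairing with `(p,
  -- ρ)`, of norm `s`, gives `h2`.
  have h1 : (1 - un - a) ^ 2 + d ^ 2 ≤ a ^ 2 := by
    have h2 := mul_le_mul_of_nonneg_left hG (sq_nonneg W)
    have h3 : W ^ 2 * ((1 - un) ^ 2 * (1 - vv) + (1 - uu) * (1 - vn) ^ 2)
        = (1 - un) ^ 2 + d ^ 2 := by
      rw [hd, ← hr2]
      linear_combination (1 - un) ^ 2 * hWv
    rw [h3] at h2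
    rw [ha] at *
    linarith
  have h2 : p * (1 - un - a) + ρ * d ≤ s * a := by
    refine le_of_sq_le_sq ?_ (by positivity)
    rw [mul_pow, hs2]
    have := mul_le_mul_of_nonneg_left h1 (by positivity : 0 ≤ ρ ^ 2 + p ^ 2)
    linarith [sq_nonneg (p * d - ρ * (1 - un - a))]
  have h3 := mul_le_mul_of_nonneg_right hh ha0
  rw [ha, hd] at *
  linarith

/-- The light-like direction `(1, -n)` pairs nonnegatively with the magnetic part. -/
theorem magnetic_flux_nonneg {u v n : Vec3} (hu : u ⬝ᵥ u < 1) (hn : n ⬝ᵥ n = 1)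
    (hun : n ⬝ᵥ u < 1) (B b : Vec3) :
    0 ≤ (1 - n ⬝ᵥ v) * (1 / 2 * ((1 - u ⬝ᵥ u) * (b - B) ⬝ᵥ (b - B) + (u ⬝ᵥ (b - B)) ^ 2)
          + 1 / 2 * (B ⬝ᵥ B * (u - v) ⬝ᵥ (u - v) - (B ⬝ᵥ (u - v)) ^ 2))
      + (n ⬝ᵥ u - n ⬝ᵥ v) * (magPressure v B - magPressure u b)
      + n ⬝ᵥ B * ((v ⬝ᵥ B * u ⬝ᵥ (u - v) - v ⬝ᵥ (u - v) * u ⬝ᵥ B)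
        + ((1 - u ⬝ᵥ u) * (u - v) ⬝ᵥ (b - B) + u ⬝ᵥ (u - v) * u ⬝ᵥ (b - B))) := by
  -- Multiplied by `2 (1 - n·u)`, the expression is quadratic in `b` with leading coefficient `(1 -
  -- n·u)²`. This vector completes the square, and the remainder is the Gram determinant of `u - v`,
  -- `n - v`, `B`. The matching uses the linear dependence of four vectors in `ℝ³`.
  have h1 := boost_form_nonneg hu
    ((1 - n ⬝ᵥ u) • b - (1 - n ⬝ᵥ v) • B - (n ⬝ᵥ B) • v + (n ⬝ᵥ B) • u)
  have h2 := gram_three (u - v) (n - v) B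
  have h3 : 0 < 2 * (1 - n ⬝ᵥ u) := by linarith
  refine nonneg_of_mul_nonneg_right ?_ h3
  have h4 := add_nonneg h1 h2
  have h5 := gram_four v u B n
  rw [hn, one_mul] at h5
  refine h4.trans_eq ?_
  simp only [magPressure, add_dotProduct, sub_dotProduct, dotProduct_sub, dotProduct_add,
    smul_dotProduct, dotProduct_smul, smul_eq_mul, hn, dotProduct_comm v n, dotProduct_comm u n,
    dotProduct_comm u v, dotProduct_comm B v, dotProduct_comm B u, dotProduct_comm b B,
    dotProduct_comm b v, dotProduct_comm b u]
  linear_combination h5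

/-- The generalized Lax-Friedrichs splitting inequality. -/
theorem Prim.IsPhysical.flux_dot_dualState_nonneg {H : ℝ → ℝ → ℝ} (hH : CausalEOS H) {w : Prim}
    (hw : w.IsPhysical H) {u : Vec3} (hu : u ⬝ᵥ u < 1) (b : Vec3) {n : Pt} (hn : ‖n‖ = 1) :
    0 ≤ (w.cons H - ∑ i : Fin 2, n i • w.flux H i) ⬝ᵥ dualState u b + magPressure u b
        - (liftVec n ⬝ᵥ u * magPressure u b - liftVec n ⬝ᵥ w.B * u ⬝ᵥ b) := by
  obtain ⟨hρ, hp, -, hv⟩ := id hw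
  have hn' : liftVec n ⬝ᵥ liftVec n = 1 := by rw [liftVec_dot_self, hn, one_pow]
  have lt_one : ∀ x y : Vec3, x ⬝ᵥ x ≤ 1 → y ⬝ᵥ y < 1 → x ⬝ᵥ y < 1 := by
    intro x y hx hy
    have h1 := gram_two x y
    have h2 := mul_le_mul_of_nonneg_right hx (dot_self_nonneg y)
    exact (abs_lt.1 ((sq_lt_one_iff_abs_lt_one _).1 (by linarith))).2
  have hun := lt_one _ u hn'.le hu
  have hvn := lt_one _ w.v hn'.le hv
  have huv := lt_one w.v u hv.le hu
  rw [sum_flux_dot_dualState H hv, cons_dot_dualState H hv, source_dot_dualState, ptot_eq hv]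
  -- Nonnegativity of the Minkowski Gram determinant of the light-like `(1, n)` and the time-like
  -- `(1, v)`, `(1, u)`. In Euclidean terms: `(v · c)² ≤ |c|²` for `c = (u - v) × (n - v)`.
  have hG : (1 - liftVec n ⬝ᵥ u) ^ 2 * (1 - w.v ⬝ᵥ w.v)
      + (1 - u ⬝ᵥ u) * (1 - liftVec n ⬝ᵥ w.v) ^ 2
      ≤ 2 * (1 - w.v ⬝ᵥ u) * (1 - liftVec n ⬝ᵥ w.v) * (1 - liftVec n ⬝ᵥ u) := by
    have h1 := gram_two w.v (crossProduct (u - w.v) (liftVec n - w.v))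
    have h2 := mul_le_mul_of_nonneg_right hv.le
      (dot_self_nonneg (crossProduct (u - w.v) (liftVec n - w.v)))
    have h3 : (w.v ⬝ᵥ crossProduct (u - w.v) (liftVec n - w.v)) ^ 2
        = w.v ⬝ᵥ w.v * (u ⬝ᵥ u - (liftVec n ⬝ᵥ u) ^ 2)
          - w.v ⬝ᵥ u * (w.v ⬝ᵥ u - liftVec n ⬝ᵥ u * liftVec n ⬝ᵥ w.v)
          + liftVec n ⬝ᵥ w.v * (w.v ⬝ᵥ u * liftVec n ⬝ᵥ u - u ⬝ᵥ u * liftVec n ⬝ᵥ w.v) := by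
      have : w.v ⬝ᵥ w.v * (u ⬝ᵥ u * liftVec n ⬝ᵥ liftVec n - (liftVec n ⬝ᵥ u) ^ 2)
          - w.v ⬝ᵥ u * (w.v ⬝ᵥ u * liftVec n ⬝ᵥ liftVec n - liftVec n ⬝ᵥ u * liftVec n ⬝ᵥ w.v)
          + liftVec n ⬝ᵥ w.v * (w.v ⬝ᵥ u * liftVec n ⬝ᵥ u - u ⬝ᵥ u * liftVec n ⬝ᵥ w.v)
          = (w.v ⬝ᵥ crossProduct (u - w.v) (liftVec n - w.v)) ^ 2 := by
        generalize liftVec n = m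
        simp only [cross_apply, dot_eq, Pi.sub_apply, Matrix.cons_val_zero, Matrix.cons_val_one,
          Matrix.cons_val]
        ring
      rw [← this, hn']
      ring
    have h4 : crossProduct (u - w.v) (liftVec n - w.v) ⬝ᵥ
        crossProduct (u - w.v) (liftVec n - w.v)
        = (u ⬝ᵥ u + w.v ⬝ᵥ w.v - 2 * w.v ⬝ᵥ u) * (1 + w.v ⬝ᵥ w.v - 2 * liftVec n ⬝ᵥ w.v)
          - (liftVec n ⬝ᵥ u - w.v ⬝ᵥ u - liftVec n ⬝ᵥ w.v + w.v ⬝ᵥ w.v) ^ 2 := by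
      simp only [cross_dot_cross, sub_dotProduct, dotProduct_sub, hn',
        dotProduct_comm u w.v, dotProduct_comm u (liftVec n), dotProduct_comm w.v (liftVec n)]
      ring
    have h5 := h1.trans h2
    rw [h3, one_mul, h4] at h5
    linarith
  have h1 := hydro_flux_nonneg hp hρ (W_pos hv) (W_sq_mul hv) hu (hw.kinetic hH)
    hvn huv hG
  have h2 := magnetic_flux_nonneg (v := w.v) hu hn' hun w.B b
  simp only [magPressure] at h2 ⊢
  linarith

/-! ### Recovery of the primitive variables -/

theorem CausalEOS.continuousOn {H : ℝ → ℝ → ℝ} (hH : CausalEOS H) :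
    ContinuousOn (fun z : ℝ × ℝ => H z.1 z.2) (Ioi 0 ×ˢ Ioi 0) :=
  hH.differentiable.continuousOn

theorem CausalEOS.strictAntiOn {H : ℝ → ℝ → ℝ} (hH : CausalEOS H) {p : ℝ} (hp : 0 < p) :
    StrictAntiOn (H p) (Ioi 0) := by
  refine strictAntiOn_of_deriv_neg (convex_Ioi 0) ?_ ?_
  · exact hH.continuousOn.comp (f := fun ρ : ℝ => (p, ρ)) (by fun_prop) fun ρ hρ => ⟨hp, hρ⟩
  · rw [interior_Ioi]
    exact fun ρ hρ => hH.expansion p ρ hp hρ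

/-- The squared velocity as a function of `x = ρ H W²`, with `M = |m|²`, `s = m · B` and
`β = |B|²`. -/
noncomputable def speedSq (M s β x : ℝ) : ℝ := (M + s ^ 2 * (2 / x + β / x ^ 2)) / (x + β) ^ 2

/-- The thermal pressure as a function of `x = ρ H W²`. -/
noncomputable def pressureOf (E M s β x : ℝ) : ℝ :=
  x - E + β / 2 + (M * β - s ^ 2) / (2 * (x + β) ^ 2)

section Recovery

variable {M s β : ℝ}

theorem speedSq_nonneg (hM : 0 ≤ M) (hβ : 0 ≤ β) {x : ℝ} (hx : 0 < x) :
    0 ≤ speedSq M s β x := by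
  unfold speedSq; positivity

theorem speedSq_antitone (hM : 0 ≤ M) (hβ : 0 ≤ β) {x y : ℝ} (hx : 0 < x) (hxy : x ≤ y) :
    speedSq M s β y ≤ speedSq M s β x := by
  unfold speedSq; gcongr

theorem continuousOn_speedSq (hβ : 0 ≤ β) : ContinuousOn (speedSq M s β) (Ioi 0) := by
  unfold speedSq
  have h : ∀ x ∈ Ioi (0 : ℝ), x ≠ 0 := fun x hx => (mem_Ioi.1 hx).ne'
  have h2 : ∀ x ∈ Ioi (0 : ℝ), x ^ 2 ≠ 0 := fun x hx => pow_ne_zero 2 (h x hx)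
  have h' : ∀ x ∈ Ioi (0 : ℝ), (x + β) ^ 2 ≠ 0 := fun x hx => by
    have := mem_Ioi.1 hx
    positivity
  fun_prop (disch := assumption)

theorem continuousOn_pressureOf (E : ℝ) (hβ : 0 ≤ β) :
    ContinuousOn (pressureOf E M s β) (Ioi 0) := by
  unfold pressureOf
  have h' : ∀ x ∈ Ioi (0 : ℝ), 2 * (x + β) ^ 2 ≠ 0 := fun x hx => by
    have := mem_Ioi.1 hx
    positivity
  fun_prop (disch := assumption)

/-- With `v · B = s / x`, this is `|v|²|B|² - (v · B)²`; it reconciles `pressureOf` with the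
magnetic pressure in the energy. -/
theorem speedSq_mul (hβ : 0 ≤ β) {x : ℝ} (hx : 0 < x) :
    speedSq M s β x * β - (s / x) ^ 2 = (M * β - s ^ 2) / (x + β) ^ 2 := by
  have : 0 < x + β := by linarith
  unfold speedSq
  field_simp
  ring

/-- The slope is `1 - (Mβ - s²) / (x + β)³`, and a subluminal speed at the left end bounds `(Mβ -
s²) / (x + β)²` there by `β`. -/
theorem pressureOf_strictMono (E : ℝ) (hβ : 0 ≤ β) {x y : ℝ} (hx : 0 < x)
    (hxy : x < y) (hV : speedSq M s β x < 1) : pressureOf E M s β x < pressureOf E M s β y := by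
  have hxb : 0 < x + β := by linarith
  have hyb : 0 < y + β := by linarith
  have h1 : (M * β - s ^ 2) ≤ β * (x + β) ^ 2 := by
    rw [← div_le_iff₀ (by positivity), ← speedSq_mul hβ hx]
    nlinarith [sq_nonneg (s / x)]
  have h2 : (M * β - s ^ 2) / (2 * (x + β) ^ 2) - (M * β - s ^ 2) / (2 * (y + β) ^ 2)
      = (M * β - s ^ 2) * ((y - x) * (x + y + 2 * β) / (2 * (x + β) ^ 2 * (y + β) ^ 2)) := by
    field_simp
    ring
  have h3 : (M * β - s ^ 2) * ((y - x) * (x + y + 2 * β) / (2 * (x + β) ^ 2 * (y + β) ^ 2))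
      ≤ β * (x + β) ^ 2 * ((y - x) * (x + y + 2 * β) / (2 * (x + β) ^ 2 * (y + β) ^ 2)) := by
    refine mul_le_mul_of_nonneg_right h1 ?_
    have : 0 ≤ y - x := by linarith
    have : 0 ≤ x + y + 2 * β := by linarith
    positivity
  have h4 : β * (x + β) ^ 2 * ((y - x) * (x + y + 2 * β) / (2 * (x + β) ^ 2 * (y + β) ^ 2))
      < y - x := by
    rw [mul_div_assoc', div_lt_iff₀ (by positivity)]
    have h5 : β * (x + y + 2 * β) < 2 * (y + β) ^ 2 := by nlinarith
    have h6 : 0 < (y - x) * (x + β) ^ 2 := mul_pos (by linarith) (by positivity)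
    nlinarith [mul_lt_mul_of_pos_left h5 h6]
  unfold pressureOf
  linarith

/-- The scalar equation that determines the primitive variables has a solution. -/
theorem exists_enthalpy_root {H : ℝ → ℝ → ℝ} (hH : CausalEOS H) {D E : ℝ} (hD : 0 < D)
    (hM : 0 ≤ M) (hβ : 0 ≤ β) (hc : s ^ 2 ≤ M * β)
    (hpos : ∀ x, 0 < x → speedSq M s β x < 1 → pressureOf E M s β x
      < x * (1 - speedSq M s β x) - D * √(1 - speedSq M s β x)) :
    ∃ x, 0 < x ∧ speedSq M s β x < 1 ∧ 0 < pressureOf E M s β x ∧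
      D * √(1 - speedSq M s β x) * H (pressureOf E M s β x) (D * √(1 - speedSq M s β x))
        = x * (1 - speedSq M s β x) := by
  have hVc := continuousOn_speedSq (M := M) (s := s) hβ
  have hPc := continuousOn_pressureOf (M := M) (s := s) E hβ
  have hV0 : ∀ {x}, 0 < x → 0 ≤ speedSq M s β x := fun hx => speedSq_nonneg hM hβ hx
  set N := M + s ^ 2 * (2 + β) with hN
  have hN0 : 0 ≤ N := by positivity
  -- Large enough that `X² (1 - V(X)) ≥ D²`, with `V` the squared speed, and that `2 (X - E) ≥ X`;
  -- the last needs the factor 2 on `|E|`.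
  set X := 1 + D + N + 2 * |E| with hX
  have hE := neg_abs_le E
  have hE' := le_abs_self E
  have hE0 := abs_nonneg E
  have hX1 : 1 ≤ X := by linarith
  have hX0 : 0 < X := by linarith
  have hPX : X - E ≤ pressureOf E M s β X := by
    have : 0 ≤ (M * β - s ^ 2) / (2 * (X + β) ^ 2) := div_nonneg (by linarith) (by positivity)
    unfold pressureOf
    linarith
  have hVX : X ^ 2 * speedSq M s β X ≤ N := by
    have h1 : speedSq M s β X ≤ N / X ^ 2 := by
      unfold speedSq
      have h2 : (2 / X + β / X ^ 2) ≤ 2 + β := by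
        refine add_le_add (div_le_self (by norm_num) hX1) (div_le_self hβ ?_)
        exact one_le_pow₀ hX1
      rw [hN]
      gcongr
      linarith
    rw [le_div_iff₀ (by positivity)] at h1
    linarith
  -- Here `a √(1 - V(a)) = D`, so the upper bound in `hpos` is zero and the pressure at `a` is
  -- negative.
  obtain ⟨a, ⟨ha1, ha2⟩, ha⟩ : ∃ a ∈ Icc D X, a ^ 2 * (1 - speedSq M s β a) = D ^ 2 := by
    have hcont : ContinuousOn (fun x => x ^ 2 * (1 - speedSq M s β x)) (Icc D X) :=
      ((continuous_pow 2).continuousOn.mul (continuousOn_const.sub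
        (hVc.mono fun x hx => hD.trans_le hx.1)))
    refine intermediate_value_Icc (by linarith) hcont ⟨?_, ?_⟩
    · have := mul_nonneg (sq_nonneg D) (hV0 hD)
      linarith
    · nlinarith
  have ha0 : 0 < a := hD.trans_le ha1
  have hVa : speedSq M s β a < 1 := by
    have : 0 < a ^ 2 * (1 - speedSq M s β a) := by rw [ha]; positivity
    have := pos_of_mul_pos_right this (sq_nonneg a)
    linarith
  have hPa : pressureOf E M s β a < 0 := by
    refine (hpos a ha0 hVa).trans_le (le_of_eq ?_)
    have h1 : (1 - speedSq M s β a) = √(1 - speedSq M s β a) ^ 2 :=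
      (Real.sq_sqrt (by linarith)).symm
    have h2 : a * √(1 - speedSq M s β a) = D := by
      rw [h1, ← mul_pow] at ha
      exact (pow_left_inj₀ (by positivity) hD.le two_ne_zero).1 ha
    nth_rewrite 1 [h1]
    linear_combination √(1 - speedSq M s β a) * h2
  obtain ⟨x₀, ⟨hx1, hx2⟩, hx0⟩ : ∃ x ∈ Icc a X, pressureOf E M s β x = 0 :=
    intermediate_value_Icc ha2 (hPc.mono fun x hx => ha0.trans_le hx.1) ⟨hPa.le, by linarith⟩
  have hx₀ : 0 < x₀ := ha0.trans_le hx1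
  have hV1 : ∀ x, a ≤ x → speedSq M s β x < 1 := fun x hx =>
    (speedSq_antitone hM hβ ha0 hx).trans_lt hVa
  have hx0X : x₀ < X := by
    refine lt_of_le_of_ne hx2 ?_
    rintro rfl
    linarith
  have hP : ∀ x, x₀ < x → 0 < pressureOf E M s β x := fun x hx => by
    rw [← hx0]
    exact pressureOf_strictMono E hβ hx₀ hx (hV1 _ hx1)
  set ρ : ℝ → ℝ := fun x => D * √(1 - speedSq M s β x) with hρ
  have hρpos : ∀ x, a ≤ x → 0 < ρ x := fun x hx => by
    have : 0 < 1 - speedSq M s β x := sub_pos.2 (hV1 x hx)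
    simp only [hρ]; positivity
  have hρc : ContinuousOn ρ (Ioi 0) := by
    simp only [hρ]
    exact continuousOn_const.mul (continuousOn_const.sub hVc).sqrt
  have hgap := hpos x₀ hx₀ (hV1 _ hx1)
  rw [hx0] at hgap
  -- As the pressure tends to zero, `H` tends to 1, and `hgap` reads `ρ x₀ < x₀ (1 - V(x₀))`. The
  -- limit is given only at fixed density; since `ρ x ≥ ρ x₀` and `H` decreases in the density,
  -- density `ρ x₀` suffices.
  obtain ⟨y, hy1, hy2, hy⟩ : ∃ y, x₀ < y ∧ y < X ∧
      ρ y * H (pressureOf E M s β y) (ρ y) < y * (1 - speedSq M s β y) := by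
    have hlt : 𝓝[>] x₀ ≤ 𝓝 x₀ := nhdsWithin_le_nhds
    have t1 : Tendsto (fun x => ρ x * H (pressureOf E M s β x) (ρ x₀)) (𝓝[>] x₀)
        (𝓝 (ρ x₀ * 1)) := by
      refine Tendsto.mul ((hρc.continuousAt (Ioi_mem_nhds hx₀)).tendsto.mono_left hlt) ?_
      refine (hH.cold _ (hρpos _ hx1)).comp (tendsto_nhdsWithin_iff.2 ⟨?_, ?_⟩)
      · rw [← hx0]
        exact (hPc.continuousAt (Ioi_mem_nhds hx₀)).tendsto.mono_left hlt
      · filter_upwards [self_mem_nhdsWithin] with x hx using hP x hx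
    have t2 : Tendsto (fun x => x * (1 - speedSq M s β x)) (𝓝[>] x₀)
        (𝓝 (x₀ * (1 - speedSq M s β x₀))) :=
      (tendsto_id.mul (tendsto_const_nhds.sub
        (hVc.continuousAt (Ioi_mem_nhds hx₀)).tendsto)).mono_left hlt
    have h := t1.eventually_lt t2 (by simp only [hρ]; linarith)
    obtain ⟨y, hy, hy1, hy2⟩ := (h.and (Ioo_mem_nhdsGT hx0X)).exists
    refine ⟨y, hy1, hy2, lt_of_le_of_lt ?_ hy⟩
    have hay : a ≤ y := hx1.trans hy1.le
    refine mul_le_mul_of_nonneg_left ?_ (hρpos y hay).le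
    refine (hH.strictAntiOn (hP y hy1)).antitoneOn (hρpos _ hx1) (hρpos _ hay) ?_
    simp only [hρ]
    have := speedSq_antitone (s := s) hM hβ hx₀ hy1.le
    gcongr
  have hfin : ContinuousOn
      (fun x => ρ x * H (pressureOf E M s β x) (ρ x) - x * (1 - speedSq M s β x)) (Icc y X) := by
    have hsub : Icc y X ⊆ Ioi 0 := fun x hx => hx₀.trans (hy1.trans_le hx.1)
    refine ((hρc.mono hsub).mul ?_).sub
      (continuousOn_id.mul (continuousOn_const.sub (hVc.mono hsub)))
    exact hH.continuousOn.comp ((hPc.mono hsub).prodMk (hρc.mono hsub)) fun x hx =>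
      ⟨hP x (hy1.trans_le hx.1), hρpos x (hx1.trans (hy1.le.trans hx.1))⟩
  -- At `X` the sign is reversed: with `P` the pressure, `ρ H ≥ 2 P(X) ≥ 2 (X - E) ≥ X ≥ X (1 -
  -- V(X))`.
  obtain ⟨x, ⟨hxy, hxX⟩, hx⟩ := intermediate_value_Icc hy2.le hfin
    (show (0 : ℝ) ∈ _ from ⟨by linarith, by
      have h1 := hH.kinetic_density (hP X hx0X) (hρpos X ha2)
      have h2 : pressureOf E M s β X ≤ √(ρ X ^ 2 + pressureOf E M s β X ^ 2) :=
        Real.le_sqrt_of_sq_le (by linarith [sq_nonneg (ρ X)])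
      have h3 := mul_nonneg hX0.le (hV0 hX0)
      linarith⟩)
  exact ⟨x, hx₀.trans (hy1.trans_le hxy), hV1 x (hx1.trans (hy1.le.trans hxy)),
    hP x (hy1.trans_le hxy), sub_eq_zero.1 hx⟩

end Recovery

theorem state_eq_mkState (U : State) :
    U = mkState (U 0) ![U 1, U 2, U 3] (magnetic U) (U 7) := by
  ext i
  fin_cases i <;> rfl

/-- A state with positive density that pairs positively with all dual states is admissible. -/
theorem mem_admissible_of_dot_dualState_pos {H : ℝ → ℝ → ℝ} (hH : CausalEOS H) {U : State}
    (hD : 0 < U 0)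
    (hU : ∀ u b : Vec3, u ⬝ᵥ u < 1 → 0 < U ⬝ᵥ dualState u b + magPressure u b) :
    U ∈ admissible H := by
  rw [state_eq_mkState U] at hU ⊢
  generalize U 0 = D, (![U 1, U 2, U 3] : Vec3) = m, magnetic U = B, U 7 = E at *
  set M := m ⬝ᵥ m with hM
  set s := m ⬝ᵥ B with hs
  set β := B ⬝ᵥ B with hβ
  have hM0 : 0 ≤ M := dot_self_nonneg m
  have hβ0 : 0 ≤ β := dot_self_nonneg B
  have hc : s ^ 2 ≤ M * β := gram_two m B
  -- The momentum equation solved for the velocity at given `x = ρ H W²`; its product with `B` gives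
  -- `v · B = s / x`.
  set vel : ℝ → Vec3 := fun x => (1 / (x + β)) • (m + (s / x) • B) with hvel
  have hvv : ∀ x, 0 < x → vel x ⬝ᵥ vel x = speedSq M s β x := fun x hx => by
    have : 0 < x + β := by linarith
    simp only [hvel, smul_dotProduct, dotProduct_smul, add_dotProduct, dotProduct_add,
      smul_eq_mul, dotProduct_comm B m, ← hM, ← hs, ← hβ, speedSq]
    field_simp
    ring
  have hvB : ∀ x, 0 < x → vel x ⬝ᵥ B = s / x := fun x hx => by
    have : 0 < x + β := by linarith
    simp only [hvel, smul_dotProduct, add_dotProduct, smul_eq_mul, ← hs, ← hβ]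
    field_simp
  have hmv : ∀ x, 0 < x → m ⬝ᵥ vel x = x * speedSq M s β x + β * speedSq M s β x
      - (s / x) ^ 2 := fun x hx => by
    have : 0 < x + β := by linarith
    simp only [hvel, dotProduct_smul, dotProduct_add, smul_eq_mul, ← hs, ← hM, speedSq]
    field_simp
    ring
  have hpos : ∀ x, 0 < x → speedSq M s β x < 1 → pressureOf E M s β x
      < x * (1 - speedSq M s β x) - D * √(1 - speedSq M s β x) := fun x hx hx1 => by
    -- Among all dual states, only those of the candidate velocity and the actual field are tested.
    have h := hU (vel x) B (by rwa [hvv x hx])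
    simp only [dualState, magPressure, mkState_dot, dotProduct_neg, dotProduct_add,
      dotProduct_smul, smul_eq_mul, hvv x hx, dotProduct_comm B (vel x), hvB x hx, hmv x hx,
      ← hβ] at h
    have h2 := speedSq_mul (M := M) (s := s) hβ0 hx
    have h3 : (M * β - s ^ 2) / (2 * (x + β) ^ 2) = 1 / 2 * ((M * β - s ^ 2) / (x + β) ^ 2) := by
      field_simp
    rw [pressureOf, h3, ← h2]
    linarith
  obtain ⟨x, hx, hx1, hp, hroot⟩ := exists_enthalpy_root hH hD hM0 hβ0 hc hpos
  have hr : 0 < 1 - speedSq M s β x := by linarith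
  set ρ := D * √(1 - speedSq M s β x) with hρ
  have hρ0 : 0 < ρ := by positivity
  set w : Prim := ⟨ρ, pressureOf E M s β x, vel x, B⟩ with hw
  have hv : w.v ⬝ᵥ w.v < 1 := by rw [hw]; simpa only [hvv x hx] using hx1
  have hWv : w.W ^ 2 * (1 - speedSq M s β x) = 1 := by rw [← hvv x hx]; exact Prim.W_sq_mul hv
  have hx' : w.ρ * w.enthalpy H * w.W ^ 2 = x := by
    have : w.ρ * w.enthalpy H = x * (1 - speedSq M s β x) := hroot
    rw [this]
    linear_combination x * hWv
  refine ⟨w, ⟨hρ0, hp, ?_, hv⟩, ?_⟩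
  · have h1 := hH.kinetic _ _ hp hρ0
    have h2 : 1 < √(1 + pressureOf E M s β x ^ 2 / ρ ^ 2) := by
      rw [Real.lt_sqrt zero_le_one]
      have : 0 < pressureOf E M s β x ^ 2 / ρ ^ 2 := by positivity
      linarith
    have : w.energy H = H (pressureOf E M s β x) ρ - 1 - pressureOf E M s β x / ρ := rfl
    rw [this]
    linarith
  · rw [Prim.cons, hx', Prim.momentum, hx', Prim.ptot_eq hv]
    have hvB' : w.v ⬝ᵥ w.B = s / x := hvB x hx
    have hvv' : w.v ⬝ᵥ w.v = speedSq M s β x := hvv x hx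
    rw [hvB', hvv']
    have e1 : w.ρ * w.W = D := by
      change ρ * (1 / √(1 - vel x ⬝ᵥ vel x)) = D
      rw [hvv x hx, hρ]
      field_simp
    have hxb : 0 < x + β := by linarith
    have e2 : (x + w.B ⬝ᵥ w.B) • w.v - (s / x) • w.B = m := by
      change (x + β) • ((1 / (x + β)) • (m + (s / x) • B)) - (s / x) • B = m
      rw [smul_smul, mul_one_div_cancel hxb.ne', one_smul, add_sub_cancel_right]
    have e3 : x - (w.p + 1 / 2 * ((1 - speedSq M s β x) * w.B ⬝ᵥ w.B + (s / x) ^ 2))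
        + w.B ⬝ᵥ w.B = E := by
      change x - (pressureOf E M s β x + 1 / 2 * ((1 - speedSq M s β x) * β + (s / x) ^ 2))
        + β = E
      have h2 := speedSq_mul (M := M) (s := s) hβ0 hx
      have h3 : (M * β - s ^ 2) / (2 * (x + β) ^ 2)
          = 1 / 2 * ((M * β - s ^ 2) / (x + β) ^ 2) := by
        field_simp
      rw [pressureOf, h3, ← h2]
      ring
    rw [e1, e2, e3]

/-! ### The fundamental theorem of calculus on a one-dimensional polyhedral set -/

section Slice

variable {ε : Type*} {E : Finset ε} {S : Set ℝ} {pt σ : ε → ℝ}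

/-- The half-line below `p`, closed if `s = 1`. -/
noncomputable def halfLine (s p : ℝ) : Set ℝ := if s = 1 then Iic p else Iio p

theorem halfLine_indicator_of_lt {s p y : ℝ} (h : y < p) :
    (halfLine s p).indicator (fun _ => (1 : ℝ)) y = 1 := by
  unfold halfLine
  split_ifs
  · exact indicator_of_mem (mem_Iic.2 h.le) _
  · exact indicator_of_mem (mem_Iio.2 h) _

theorem halfLine_indicator_of_gt {s p y : ℝ} (h : p < y) :
    (halfLine s p).indicator (fun _ => (1 : ℝ)) y = 0 := by
  unfold halfLine
  split_ifs
  · exact indicator_of_notMem (notMem_Iic.2 h) _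
  · exact indicator_of_notMem (notMem_Iio.2 h.le) _

theorem halfLine_indicator_eventuallyEq {s p x : ℝ} (h : p ≠ x) :
    ∀ᶠ y in 𝓝 x, (halfLine s p).indicator (fun _ => (1 : ℝ)) y
      = (halfLine s p).indicator (fun _ => (1 : ℝ)) x := by
  rcases h.lt_or_gt with h | h
  · filter_upwards [Ioi_mem_nhds h] with y hy
    rw [halfLine_indicator_of_gt h, halfLine_indicator_of_gt hy]
  · filter_upwards [Iio_mem_nhds h] with y hy
    rw [halfLine_indicator_of_lt h, halfLine_indicator_of_lt hy]

/-- A compact set that lies locally on one side of its finitely many boundary points has an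
indicator function that is a signed sum of indicators of half-lines. -/
theorem indicator_eq_sum_halfLine (hS : IsCompact S)
    (hσ : ∀ e ∈ E, σ e = 1 ∨ σ e = -1)
    (hinj : ∀ e ∈ E, ∀ e' ∈ E, e ≠ e' → pt e ≠ pt e')
    (hloc : ∀ e ∈ E, ∀ᶠ y in 𝓝 (pt e), y ∈ S ↔ σ e * (y - pt e) ≤ 0)
    (hfr : ∀ x ∈ frontier S, ∃ e ∈ E, pt e = x) (x : ℝ) :
    S.indicator (fun _ => (1 : ℝ)) x
      = ∑ e ∈ E, σ e * (halfLine (σ e) (pt e)).indicator (fun _ => (1 : ℝ)) x := by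
  classical
  -- `F` is locally constant: at each boundary point the term of that point cancels the jump, the
  -- choice of closed or open half-line matching the value at the point itself. It vanishes to the
  -- right of everything.
  set F : ℝ → ℝ := fun x => S.indicator (fun _ => (1 : ℝ)) x
    - ∑ e ∈ E, σ e * (halfLine (σ e) (pt e)).indicator (fun _ => (1 : ℝ)) x with hF
  have hlc : IsLocallyConstant F := by
    rw [IsLocallyConstant.iff_eventually_eq]
    intro x
    by_cases hx : ∃ e ∈ E, pt e = x
    · obtain ⟨e, he, rfl⟩ := hx
      have h1 : ∀ᶠ y in 𝓝 (pt e), ∀ e' ∈ E.erase e,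
          (halfLine (σ e') (pt e')).indicator (fun _ => (1 : ℝ)) y
            = (halfLine (σ e') (pt e')).indicator (fun _ => (1 : ℝ)) (pt e) := by
        rw [eventually_all_finset]
        intro e' he'
        exact halfLine_indicator_eventuallyEq
          (hinj e' (Finset.mem_of_mem_erase he') e he (Finset.ne_of_mem_erase he'))
      have key : ∀ y, (y ∈ S ↔ σ e * (y - pt e) ≤ 0) →
          S.indicator (fun _ => (1 : ℝ)) y
            - σ e * (halfLine (σ e) (pt e)).indicator (fun _ => (1 : ℝ)) y
            = if σ e = 1 then 0 else 1 := by
        intro y hy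
        rcases hσ e he with h | h
        · have : y ∈ S ↔ y ∈ Iic (pt e) := by
            rw [hy, h, mem_Iic]; constructor <;> intro <;> linarith
          simp only [h, halfLine, if_true, indicator_apply, this]
          simp
        · have h' : ¬ (-1 : ℝ) = 1 := by norm_num
          have : y ∈ S ↔ ¬ y ∈ Iio (pt e) := by
            rw [hy, h, mem_Iio, not_lt]; constructor <;> intro <;> linarith
          simp only [h, halfLine, if_neg h', indicator_apply, this]
          by_cases hy : y ∈ Iio (pt e) <;> simp [hy]
      have h2 : pt e ∈ S ↔ σ e * (pt e - pt e) ≤ 0 := (hloc e he).self_of_nhds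
      filter_upwards [h1, hloc e he] with y hy1 hy2
      simp only [hF]
      rw [← Finset.add_sum_erase E _ he, ← Finset.add_sum_erase E _ he, ← sub_sub, ← sub_sub,
        key y hy2, key _ h2, Finset.sum_congr rfl fun e' he' => by rw [hy1 e' he']]
    · push Not at hx
      have h1 : ∀ᶠ y in 𝓝 x, ∀ e' ∈ E,
          (halfLine (σ e') (pt e')).indicator (fun _ => (1 : ℝ)) y
            = (halfLine (σ e') (pt e')).indicator (fun _ => (1 : ℝ)) x := by
        rw [eventually_all_finset]
        exact fun e' he' => halfLine_indicator_eventuallyEq (hx e' he')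
      have h2 : ∀ᶠ y in 𝓝 x, S.indicator (fun _ => (1 : ℝ)) y
          = S.indicator (fun _ => (1 : ℝ)) x := by
        have hn : x ∉ frontier S := fun h => by
          obtain ⟨e, he, h⟩ := hfr x h
          exact hx e he h
        by_cases hxS : x ∈ S
        · have : x ∈ interior S := by
            by_contra h
            exact hn ⟨subset_closure hxS, h⟩
          filter_upwards [mem_interior_iff_mem_nhds.1 this] with y hy
          rw [indicator_of_mem hy, indicator_of_mem hxS]
        · filter_upwards [hS.isClosed.isOpen_compl.mem_nhds hxS] with y hy
          rw [indicator_of_notMem hy, indicator_of_notMem hxS]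
      filter_upwards [h1, h2] with y hy1 hy2
      simp only [hF]
      rw [hy2, Finset.sum_congr rfl fun e' he' => by rw [hy1 e' he']]
  have hzero : ∃ z, F z = 0 := by
    have h1 : ∀ᶠ z in atTop, ∀ e ∈ E, pt e < z := by
      rw [eventually_all_finset]
      exact fun e _ => eventually_gt_atTop _
    obtain ⟨b, hb⟩ := hS.bddAbove
    obtain ⟨z, hz1, hz2⟩ := (h1.and (eventually_gt_atTop b)).exists
    refine ⟨z, ?_⟩
    simp only [hF]
    rw [indicator_of_notMem fun h => (hb h).not_gt hz2, Finset.sum_eq_zero, sub_zero]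
    intro e he
    rw [halfLine_indicator_of_gt (hz1 e he), mul_zero]
  obtain ⟨z, hz⟩ := hzero
  have := hlc.apply_eq_of_preconnectedSpace x z
  rw [hz] at this
  exact sub_eq_zero.1 this

/-- Integration of the half-line decomposition. Evaluated to the left of everything, that
decomposition gives `∑ σ e = 0`, which removes the base value `g a`. -/
theorem setIntegral_eq_sum_boundary (hS : IsCompact S)
    (hσ : ∀ e ∈ E, σ e = 1 ∨ σ e = -1)
    (hinj : ∀ e ∈ E, ∀ e' ∈ E, e ≠ e' → pt e ≠ pt e')
    (hloc : ∀ e ∈ E, ∀ᶠ y in 𝓝 (pt e), y ∈ S ↔ σ e * (y - pt e) ≤ 0)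
    (hfr : ∀ x ∈ frontier S, ∃ e ∈ E, pt e = x) {g g' : ℝ → ℝ}
    (hg : ∀ x, HasDerivAt g (g' x) x) (hg' : Continuous g') :
    ∫ x in S, g' x = ∑ e ∈ E, σ e * g (pt e) := by
  have hind := indicator_eq_sum_halfLine hS hσ hinj hloc hfr
  obtain ⟨a, haS, haE⟩ : ∃ a, (∀ x ∈ S, a < x) ∧ ∀ e ∈ E, a < pt e := by
    have h1 : ∀ᶠ z in atBot, ∀ e ∈ E, z < pt e := by
      rw [eventually_all_finset]
      exact fun e _ => eventually_lt_atBot _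
    obtain ⟨b, hb⟩ := hS.bddBelow
    obtain ⟨z, hz1, hz2⟩ := (h1.and (eventually_lt_atBot b)).exists
    exact ⟨z, fun x hx => hz2.trans_le (hb hx), hz1⟩
  obtain ⟨b, hbS, hbE⟩ : ∃ b, (∀ x ∈ S, x < b) ∧ ∀ e ∈ E, pt e < b := by
    have h1 : ∀ᶠ z in atTop, ∀ e ∈ E, pt e < z := by
      rw [eventually_all_finset]
      exact fun e _ => eventually_gt_atTop _
    obtain ⟨b, hb⟩ := hS.bddAbove
    obtain ⟨z, hz1, hz2⟩ := (h1.and (eventually_gt_atTop b)).exists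
    exact ⟨z, fun x hx => (hb hx).trans_lt hz2, hz1⟩
  have hsum0 : ∑ e ∈ E, σ e = 0 := by
    have h := hind a
    rw [indicator_of_notMem fun h => (haS a h).false] at h
    rw [h]
    exact Finset.sum_congr rfl fun e he => by rw [halfLine_indicator_of_lt (haE e he), mul_one]
  have hmeas : ∀ e, MeasurableSet (halfLine (σ e) (pt e)) := fun e => by
    unfold halfLine
    split_ifs
    exacts [measurableSet_Iic, measurableSet_Iio]
  have hint : IntegrableOn g' (Ioc a b) := hg'.integrableOn_Ioc
  have hone : ∀ e ∈ E, ∫ x in Ioc a b, (halfLine (σ e) (pt e)).indicator g' x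
      = g (pt e) - g a := fun e he => by
    rw [setIntegral_indicator (hmeas e),
      ← intervalIntegral.integral_eq_sub_of_hasDerivAt (fun x _ => hg x)
        (hg'.intervalIntegrable _ _), intervalIntegral.integral_of_le (haE e he).le]
    unfold halfLine
    split_ifs
    · rw [Ioc_inter_Iic, min_eq_right (hbE e he).le]
    · rw [integral_Ioc_eq_integral_Ioo]
      congr 2
      ext x
      simp only [mem_inter_iff, mem_Ioc, mem_Iio, mem_Ioo]
      have := hbE e he
      constructor
      · exact fun h => ⟨h.1.1, h.2⟩
      · exact fun h => ⟨⟨h.1, by linarith [h.2]⟩, h.2⟩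
  calc ∫ x in S, g' x = ∫ x in Ioc a b, S.indicator g' x := by
        rw [setIntegral_indicator hS.measurableSet, inter_eq_self_of_subset_right]
        exact fun x hx => ⟨haS x hx, (hbS x hx).le⟩
    _ = ∫ x in Ioc a b, ∑ e ∈ E, σ e * (halfLine (σ e) (pt e)).indicator g' x := by
        congr 1
        ext x
        have h := congrArg (· * g' x) (hind x)
        have hi : ∀ T : Set ℝ, T.indicator (fun _ => (1 : ℝ)) x * g' x = T.indicator g' x :=
          fun T => by by_cases hT : x ∈ T <;> simp [hT]
        simpa only [Finset.sum_mul, mul_assoc, hi] using h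
    _ = ∑ e ∈ E, σ e * (g (pt e) - g a) := by
        rw [integral_finsetSum]
        · refine Finset.sum_congr rfl fun e he => ?_
          rw [integral_const_mul, hone e he]
        · exact fun e _ => (hint.indicator (hmeas e)).const_mul _
    _ = _ := by
        simp only [mul_sub, Finset.sum_sub_distrib, ← Finset.sum_mul, hsum0, zero_mul, sub_zero]

end Slice

/-! ### The divergence theorem on a polygonal cell -/

/-- The point of the plane with `i`-th coordinate `s` and other coordinate `t`. -/
noncomputable def planePt (i : Fin 2) (s t : ℝ) : Pt :=
  WithLp.toLp 2 (fun l => if l = i then s else t)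

@[simp] theorem planePt_self (i : Fin 2) (s t : ℝ) : planePt i s t i = s := by simp [planePt]

@[simp] theorem planePt_rev (i : Fin 2) (s t : ℝ) : planePt i s t i.rev = t := by
  fin_cases i <;> simp [planePt]

theorem planePt_eta (i : Fin 2) (x : Pt) : planePt i (x i) (x i.rev) = x := by
  ext l
  fin_cases i <;> fin_cases l <;> simp [planePt]

theorem sum_fin_two_rev (i : Fin 2) (f : Fin 2 → ℝ) : ∑ l, f l = f i + f i.rev := by
  fin_cases i
  · simp
  · simp [add_comm]

theorem inner_eq_rev (i : Fin 2) (x y : Pt) : inner ℝ x y = x i * y i + x i.rev * y i.rev := by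
  rw [PiLp.inner_apply, sum_fin_two_rev i]
  simp [mul_comm]

theorem norm_sq_eq_rev (i : Fin 2) (x : Pt) : ‖x‖ ^ 2 = x i ^ 2 + x i.rev ^ 2 := by
  rw [EuclideanSpace.norm_sq_eq, sum_fin_two_rev i]
  simp

theorem continuous_planePt (i : Fin 2) : Continuous fun z : ℝ × ℝ => planePt i z.1 z.2 := by
  unfold planePt
  refine (PiLp.continuous_toLp 2 _).comp (continuous_pi fun l => ?_)
  split_ifs <;> fun_prop

theorem measurePreserving_planePt (i : Fin 2) :
    MeasurePreserving (fun z : ℝ × ℝ => planePt i z.1 z.2) := by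
  have h0 : MeasurePreserving (fun z : ℝ × ℝ => planePt 0 z.1 z.2) := by
    have h : (fun z : ℝ × ℝ => planePt 0 z.1 z.2)
        = WithLp.toLp 2 ∘ (MeasurableEquiv.finTwoArrow (α := ℝ)).symm := by
      funext z
      ext l
      fin_cases l <;> simp [planePt, MeasurableEquiv.finTwoArrow]
    rw [h]
    exact (PiLp.volume_preserving_toLp (Fin 2)).comp (volume_preserving_finTwoArrow ℝ).symm
  fin_cases i
  · exact h0
  · have h : (fun z : ℝ × ℝ => planePt 1 z.1 z.2)
        = (fun z : ℝ × ℝ => planePt 0 z.1 z.2) ∘ Prod.swap := by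
      funext z
      ext l
      fin_cases l <;> simp [planePt]
    change MeasurePreserving (fun z : ℝ × ℝ => planePt 1 z.1 z.2)
    rw [h]
    exact h0.comp (Measure.measurePreserving_swap (μ := volume) (ν := volume))

theorem measurableEmbedding_planePt (i : Fin 2) :
    MeasurableEmbedding (fun z : ℝ × ℝ => planePt i z.1 z.2) := by
  refine (continuous_planePt i).measurableEmbedding fun z z' h => ?_
  have h1 := congrArg (fun x : Pt => x i) h
  have h2 := congrArg (fun x : Pt => x i.rev) h
  simp only [planePt_self, planePt_rev] at h1 h2
  exact Prod.ext h1 h2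

theorem hasDerivAt_pval_planePt (i : Fin 2) (f : MvPolynomial (Fin 2) ℝ) (s t : ℝ) :
    HasDerivAt (fun s => pval f (planePt i s t)) (pval (MvPolynomial.pderiv i f) (planePt i s t))
      s := by
  induction f using MvPolynomial.induction_on with
  | C a => simpa [pval] using hasDerivAt_const s a
  | add p q hp hq =>
    simp only [pval_add, map_add]
    exact hp.add hq
  | mul_X p l hp =>
    have hl : HasDerivAt (fun s => planePt i s t l)
        (pval (MvPolynomial.pderiv i (MvPolynomial.X l)) (planePt i s t)) s := by
      by_cases h : l = i
      · subst h
        simpa [pval] using! hasDerivAt_id s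
      · have h' : i ≠ l := fun h' => h h'.symm
        simpa [pval, planePt, h, MvPolynomial.pderiv_X_of_ne h] using hasDerivAt_const s t
    have := hp.mul hl
    simp only [pval, map_mul, MvPolynomial.eval_X, Derivation.leibniz, map_add,
      smul_eq_mul] at this ⊢
    refine this.congr_deriv ?_
    ring

theorem setIntegral_eq_iterated (i : Fin 2) {K : Set Pt} (hK : IsCompact K) {f : Pt → ℝ}
    (hf : Continuous f) :
    ∫ x in K, f x = ∫ t, ∫ s in {s | planePt i s t ∈ K}, f (planePt i s t) := by
  have hmp := measurePreserving_planePt i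
  have hme := measurableEmbedding_planePt i
  have hmK : MeasurableSet ((fun z : ℝ × ℝ => planePt i z.1 z.2) ⁻¹' K) :=
    hmp.measurable hK.measurableSet
  rw [← hmp.setIntegral_preimage_emb hme, ← integral_indicator hmK, Measure.volume_eq_prod,
    integral_prod_symm]
  · refine integral_congr_ae (Eventually.of_forall fun t => ?_)
    have hms : MeasurableSet {s | planePt i s t ∈ K} :=
      hmK.preimage (measurable_id.prodMk measurable_const)
    simp only
    rw [← integral_indicator hms]
    rfl
  · rw [← Measure.volume_eq_prod, integrable_indicator_iff hmK]
    exact (hmp.integrableOn_comp_preimage hme).2 (hf.continuousOn.integrableOn_compact hK)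

namespace PolygonalMesh

variable {ι ε : Type*} (M : PolygonalMesh ι ε)

theorem edgePoint_apply (e : ε) (τ : ℝ) (l : Fin 2) :
    M.edgePoint e τ l = M.src e l + τ * (M.tgt e l - M.src e l) := by
  simp [edgePoint, AffineMap.lineMap_apply]
  ring

theorem continuous_edgePoint (e : ε) : Continuous (M.edgePoint e) := by
  unfold edgePoint
  exact AffineMap.lineMap_continuous

/-- The signed projection of an edge is the product of the normal and the length. -/
theorem sign_mul_abs_eq {K : ι} {e : ε} (he : e ∈ M.edges K) (i : Fin 2) :
    |M.normal K e i| * M.length e = |M.tgt e i.rev - M.src e i.rev| := by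
  have h1 := M.normal_orthogonal K e he
  have h2 := norm_sq_eq_rev i (M.normal K e)
  have h3 := norm_sq_eq_rev i (M.tgt e - M.src e)
  rw [inner_eq_rev i] at h1
  rw [M.norm_normal K e he] at h2
  simp only [PiLp.sub_apply] at h1 h3
  have h4 : M.length e = ‖M.tgt e - M.src e‖ := by
    rw [length, dist_comm, dist_eq_norm]
  rw [h4, ← abs_norm (M.tgt e - M.src e), ← abs_mul, ← sq_eq_sq_iff_abs_eq_abs, mul_pow, h3]
  linear_combination (M.normal K e i * (M.tgt e i - M.src e i)
    - M.normal K e i.rev * (M.tgt e i.rev - M.src e i.rev)) * h1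
    - (M.tgt e i.rev - M.src e i.rev) ^ 2 * h2

/-- The parameter of the point of an edge at height `t`. -/
noncomputable def param (i : Fin 2) (e : ε) (t : ℝ) : ℝ :=
  (t - M.src e i.rev) / (M.tgt e i.rev - M.src e i.rev)

/-- The open range of heights of an edge. -/
def heights (i : Fin 2) (e : ε) : Set ℝ :=
  Ioo (min (M.src e i.rev) (M.tgt e i.rev)) (max (M.src e i.rev) (M.tgt e i.rev))

theorem measurableSet_heights (i : Fin 2) (e : ε) : MeasurableSet (M.heights i e) :=
  measurableSet_Ioo

theorem ne_of_mem_heights {i : Fin 2} {e : ε} {t : ℝ} (ht : t ∈ M.heights i e) :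
    M.tgt e i.rev - M.src e i.rev ≠ 0 := by
  intro h
  have h' : M.tgt e i.rev = M.src e i.rev := by linarith
  rw [heights, h', min_self, max_self, Ioo_self] at ht
  exact ht

theorem param_mem_Ioo {i : Fin 2} {e : ε} {t : ℝ} (ht : t ∈ M.heights i e) :
    M.param i e t ∈ Ioo (0 : ℝ) 1 := by
  have hne := M.ne_of_mem_heights ht
  unfold param
  rcases lt_or_gt_of_ne hne with h | h
  · rw [heights, min_eq_right (by linarith), max_eq_left (by linarith)] at ht
    refine ⟨div_pos_of_neg_of_neg (by linarith [ht.2]) h, ?_⟩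
    rw [div_lt_one_of_neg h]
    linarith [ht.1]
  · rw [heights, min_eq_left (by linarith), max_eq_right (by linarith)] at ht
    refine ⟨div_pos (by linarith [ht.1]) h, ?_⟩
    rw [div_lt_one h]
    linarith [ht.2]

theorem edgePoint_param {i : Fin 2} {e : ε} {t : ℝ}
    (h : M.tgt e i.rev - M.src e i.rev ≠ 0) :
    planePt i (M.edgePoint e (M.param i e t) i) t = M.edgePoint e (M.param i e t) := by
  have : M.edgePoint e (M.param i e t) i.rev = t := by
    rw [edgePoint_apply, param, div_mul_cancel₀ _ h]
    ring
  conv_rhs => rw [← planePt_eta i (M.edgePoint e (M.param i e t)), this]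

theorem edgePoint_mem_openSegment {e : ε} {τ : ℝ} (hτ : τ ∈ Ioo (0 : ℝ) 1) :
    M.edgePoint e τ ∈ openSegment ℝ (M.src e) (M.tgt e) := by
  rw [openSegment_eq_image_lineMap]
  exact ⟨τ, hτ, rfl⟩

/-- The integral over the heights of an edge, as an integral along the edge. -/
theorem integral_heights (i : Fin 2) (e : ε) (φ : ℝ → ℝ) :
    ∫ t in M.heights i e, φ (M.param i e t)
      = |M.tgt e i.rev - M.src e i.rev| * ∫ τ in (0 : ℝ)..1, φ τ := by
  set a := M.src e i.rev with ha
  set b := M.tgt e i.rev with hb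
  have hparam : ∀ t, M.param i e t = t / (b - a) - a / (b - a) := fun t => sub_div _ _ _
  have main : b - a ≠ 0 → ∫ t in a..b, φ (M.param i e t) = (b - a) * ∫ τ in (0 : ℝ)..1, φ τ := by
    intro hne
    simp only [hparam]
    rw [intervalIntegral.integral_comp_div_sub φ hne, smul_eq_mul, sub_self, ← sub_div,
      div_self hne]
  rcases lt_trichotomy a b with h | h | h
  · rw [heights, min_eq_left h.le, max_eq_right h.le, ← integral_Ioc_eq_integral_Ioo,
      ← intervalIntegral.integral_of_le h.le, main (by linarith), abs_of_pos (by linarith)]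
  · rw [heights, ← ha, ← hb, h]
    simp
  · rw [heights, min_eq_right h.le, max_eq_left h.le, ← integral_Ioc_eq_integral_Ioo,
      ← intervalIntegral.integral_of_le h.le, intervalIntegral.integral_symm,
      main (by linarith), abs_of_neg (by linarith)]
    ring

/-- The horizontal slices of a cell, away from the heights of the vertices. -/
theorem slice_integral (K : ι) (i : Fin 2) (f : MvPolynomial (Fin 2) ℝ) {t : ℝ}
    (ht : ∀ e ∈ M.edges K, t ≠ M.src e i.rev ∧ t ≠ M.tgt e i.rev) :
    ∫ s in {s | planePt i s t ∈ M.cell K}, pval (MvPolynomial.pderiv i f) (planePt i s t)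
      = ∑ e ∈ M.edges K, (M.heights i e).indicator
          (fun t => SignType.sign (M.normal K e i) * pval f (M.edgePoint e (M.param i e t))) t := by
  classical
  have hcont : Continuous fun s => planePt i s t :=
    (continuous_planePt i).comp (by fun_prop : Continuous fun s : ℝ => (s, t))
  have hE : ∀ e ∈ (M.edges K).filter (fun e => t ∈ M.heights i e),
      e ∈ M.edges K ∧ t ∈ M.heights i e := fun e he => Finset.mem_filter.1 he
  have hn : ∀ e ∈ M.edges K, t ∈ M.heights i e → M.normal K e i ≠ 0 := by
    intro e he hte h0
    have h := M.sign_mul_abs_eq he i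
    rw [h0, abs_zero, zero_mul] at h
    exact M.ne_of_mem_heights hte (abs_eq_zero.1 h.symm)
  have hS : IsCompact {s | planePt i s t ∈ M.cell K} := by
    refine ((M.isCompact_cell K).image (f := fun x : Pt => x i) (by fun_prop)).of_isClosed_subset
      ((M.isCompact_cell K).isClosed.preimage hcont) ?_
    intro s hs
    exact ⟨_, hs, planePt_self i s t⟩
  have hpt : ∀ e, t ∈ M.heights i e →
      planePt i (M.edgePoint e (M.param i e t) i) t = M.edgePoint e (M.param i e t) :=
    fun e he => M.edgePoint_param (M.ne_of_mem_heights he)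
  rw [setIntegral_eq_sum_boundary (E := (M.edges K).filter (fun e => t ∈ M.heights i e))
    (pt := fun e => M.edgePoint e (M.param i e t) i)
    (σ := fun e => SignType.sign (M.normal K e i)) hS ?_ ?_ ?_ ?_
    (fun s => hasDerivAt_pval_planePt i f s t) ((continuous_pval _).comp hcont)]
  · rw [Finset.sum_filter]
    refine Finset.sum_congr rfl fun e he => ?_
    rw [indicator_apply]
    split_ifs with h
    · rw [hpt e h]
    · rfl
  · intro e he
    rcases lt_or_gt_of_ne (hn e (hE e he).1 (hE e he).2) with h | h
    · right; simp [sign_neg h]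
    · left; simp [sign_pos h]
  · intro e he e' he' hne heq
    have h1 : M.edgePoint e (M.param i e t) = M.edgePoint e' (M.param i e' t) := by
      rw [← hpt e (hE e he).2, ← hpt e' (hE e' he').2]
      simp only at heq
      rw [heq]
    refine Set.disjoint_left.1 (M.edges_disjoint K e (hE e he).1 e' (hE e' he').1 hne)
      (M.edgePoint_mem_openSegment (M.param_mem_Ioo (hE e he).2)) ?_
    rw [h1]
    exact openSegment_subset_segment _ _ _
      (M.edgePoint_mem_openSegment (M.param_mem_Ioo (hE e' he').2))
  -- On the line at height `t`, the half-plane condition of the edge depends on `s` alone, with the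
  -- sign of the `i`-th component of the normal.
  · intro e he
    have h := M.normal_outward K e (hE e he).1 _
      (M.edgePoint_mem_openSegment (M.param_mem_Ioo (hE e he).2))
    rw [← hpt e (hE e he).2] at h
    filter_upwards [hcont.continuousAt.eventually h] with s hs
    rw [hs, inner_eq_rev i]
    simp only [PiLp.sub_apply, planePt_self, planePt_rev, sub_self, mul_zero, add_zero]
    have hpos := abs_pos.2 (hn e (hE e he).1 (hE e he).2)
    have hx : M.normal K e i * (s - M.edgePoint e (M.param i e t) i)
        = |M.normal K e i| * (SignType.sign (M.normal K e i)
          * (s - M.edgePoint e (M.param i e t) i)) := by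
      rw [← mul_assoc, abs_mul_sign]
    rw [hx]
    exact ⟨fun h => nonpos_of_mul_nonpos_right h hpos,
      fun h => mul_nonpos_of_nonneg_of_nonpos hpos.le h⟩
  -- Since `t` avoids the heights of the vertices, a boundary point of the slice lies inside an edge
  -- that is not parallel to the slice.
  · intro s hs
    have h1 : planePt i s t ∈ frontier (M.cell K) :=
      hcont.frontier_preimage_subset (M.cell K) hs
    rw [M.frontier_cell K] at h1
    simp only [mem_iUnion] at h1
    obtain ⟨e, he, h1⟩ := h1
    rw [segment_eq_image_lineMap] at h1
    obtain ⟨τ, hτ, h1⟩ := h1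
    change M.edgePoint e τ = _ at h1
    have h2 := congrArg (fun x : Pt => x i.rev) h1
    simp only [planePt_rev, edgePoint_apply] at h2
    have h3 := congrArg (fun x : Pt => x i) h1
    simp only [planePt_self] at h3
    obtain ⟨hs1, ht1⟩ := ht e he
    have hτ0 : 0 < τ := lt_of_le_of_ne hτ.1 (by rintro rfl; exact hs1 (by linarith))
    have hτ1 : τ < 1 := lt_of_le_of_ne hτ.2 (by rintro rfl; exact ht1 (by linarith))
    have hmem : t ∈ M.heights i e := by
      rcases lt_trichotomy (M.src e i.rev) (M.tgt e i.rev) with h | h | h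
      · rw [heights, min_eq_left h.le, max_eq_right h.le]
        constructor <;> nlinarith
      · exact absurd (by rw [← h2, h]; ring) hs1
      · rw [heights, min_eq_right h.le, max_eq_left h.le]
        constructor <;> nlinarith
    refine ⟨e, Finset.mem_filter.2 ⟨he, hmem⟩, ?_⟩
    have hne := M.ne_of_mem_heights hmem
    have : M.param i e t = τ := by
      rw [param, div_eq_iff hne]
      linarith
    simp only [this]
    exact h3

/-- The divergence theorem for polynomials on a cell of a polygonal mesh. -/
theorem integral_pderiv (K : ι) (i : Fin 2) (f : MvPolynomial (Fin 2) ℝ) :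
    ∫ x in M.cell K, pval (MvPolynomial.pderiv i f) x
      = ∑ e ∈ M.edges K, M.normal K e i * M.length e
          * ∫ τ in (0 : ℝ)..1, pval f (M.edgePoint e τ) := by
  have hgen : ∀ᵐ t : ℝ, ∀ e ∈ M.edges K, t ≠ M.src e i.rev ∧ t ≠ M.tgt e i.rev := by
    rw [Finset.eventually_all]
    intro e _
    exact (Measure.ae_ne volume _).and (Measure.ae_ne volume _)
  rw [setIntegral_eq_iterated i (M.isCompact_cell K) (continuous_pval _),
    integral_congr_ae (hgen.mono fun t ht => M.slice_integral K i f ht), integral_finsetSum]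
  · refine Finset.sum_congr rfl fun e he => ?_
    -- The change of variables produces the projected length `|n_i| |E|`, and the sign restores
    -- `n_i`.
    rw [integral_indicator (M.measurableSet_heights i e), integral_const_mul,
      M.integral_heights i e (fun τ => pval f (M.edgePoint e τ)), ← M.sign_mul_abs_eq he i,
      ← mul_assoc, ← mul_assoc, sign_mul_abs]
  · intro e _
    rw [integrable_indicator_iff (M.measurableSet_heights i e)]
    refine (Continuous.integrableOn_Ioc (continuous_const.mul ?_)).mono_set Ioo_subset_Ioc_self
    refine (continuous_pval f).comp ((M.continuous_edgePoint e).comp ?_)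
    unfold param
    fun_prop

end PolygonalMesh

/-! ### Discrete divergence theorem -/

section Quadrature

variable {ι ε : Type*} (M : PolygonalMesh ι ε) {k Q : ℕ} (R : EdgeQuadrature k Q)

theorem PolygonalMesh.area_pos (K : ι) : 0 < M.area K := by
  have hfin : volume (M.cell K) ≠ ⊤ := (M.isCompact_cell K).measure_lt_top.ne
  refine ENNReal.toReal_pos (ne_of_gt ?_) hfin
  exact (isOpen_interior.measure_pos volume (M.isConnected_interior K).nonempty).trans_le
    (measure_mono _root_.interior_subset)

/-- Without boundary the cell would be clopen in the plane, hence empty or unbounded. Nonempty edge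
sums keep the final inequality strict. -/
theorem PolygonalMesh.edges_nonempty (K : ι) : (M.edges K).Nonempty := by
  by_contra h
  rw [Finset.not_nonempty_iff_eq_empty] at h
  have hfr := M.frontier_cell K
  rw [h] at hfr
  simp only [Finset.notMem_empty, iUnion_of_empty, iUnion_empty] at hfr
  rcases isClopen_iff.1 (isClopen_iff_frontier_eq_empty.2 hfr) with h | h
  · have := (M.isConnected_interior K).nonempty.mono _root_.interior_subset
    exact this.ne_empty h
  · have := M.isCompact_cell K
    rw [h] at this
    exact noncompact_univ Pt this

theorem EdgeQuadrature.sum_weight : ∑ q, R.weight q = 1 := by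
  have := R.exact_integral 1 (by simp)
  simpa using this

theorem EdgeQuadrature.univ_nonempty (R : EdgeQuadrature k Q) :
    (Finset.univ : Finset (Fin Q)).Nonempty := by
  by_contra h
  rw [Finset.not_nonempty_iff_eq_empty] at h
  have := R.sum_weight
  rw [h, Finset.sum_empty] at this
  exact zero_ne_one this

/-- The edge quadrature is exact for polynomials in the plane. -/
theorem EdgeQuadrature.sum_edgePoint (e : ε) {f : MvPolynomial (Fin 2) ℝ}
    (hf : f.totalDegree ≤ 2 * k) :
    ∑ q, R.weight q * pval f (M.edgePoint e (R.node q))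
      = ∫ τ in (0 : ℝ)..1, pval f (M.edgePoint e τ) := by
  set P : Fin 2 → Polynomial ℝ := fun l =>
    Polynomial.C (M.src e l) + Polynomial.X * Polynomial.C (M.tgt e l - M.src e l) with hP
  have hdeg : (MvPolynomial.aeval P f).natDegree ≤ 2 * k := by
    refine (MvPolynomial.aeval_natDegree_le f hf P (n := 1) fun l => ?_).trans_eq (mul_one _)
    simp only [hP]
    compute_degree
  have heval : ∀ τ, (MvPolynomial.aeval P f).eval τ = pval f (M.edgePoint e τ) := fun τ => by
    rw [← Polynomial.coe_aeval_eq_eval, ← AlgHom.coe_toRingHom, RingHom.coe_coe,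
      MvPolynomial.comp_aeval_apply, MvPolynomial.aeval_eq_eval, pval]
    congr 2
    funext l
    simp [hP, M.edgePoint_apply]
  simpa only [heval] using R.exact_integral _ hdeg

theorem normalB_eq (n : Pt) (U : State) : normalB n U = n 0 * U 4 + n 1 * U 5 := by
  rw [normalB, Fin.sum_univ_two]
  rfl

theorem normalB_eq_liftVec_dot (n : Pt) (U : State) :
    normalB n U = liftVec n ⬝ᵥ magnetic U := by
  rw [liftVec_dot, normalB_eq]
  rfl

/-- The quadrature form of the divergence theorem on a cell. -/
theorem sum_edges_quadrature (K : ι) (f : Fin 2 → MvPolynomial (Fin 2) ℝ)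
    (hf : ∀ i, (f i).totalDegree ≤ 2 * k) :
    ∑ e ∈ M.edges K, M.length e * ∑ q, R.weight q *
        (∑ i, M.normal K e i * pval (f i) (M.edgePoint e (R.node q)))
      = ∫ x in M.cell K, pval (∑ i, MvPolynomial.pderiv i (f i)) x := by
  have h : ∀ x, pval (∑ i, MvPolynomial.pderiv i (f i)) x
      = ∑ i, pval (MvPolynomial.pderiv i (f i)) x := fun x => by simp [pval]
  simp only [h]
  rw [integral_finsetSum _ fun i _ =>
    (continuous_pval _).continuousOn.integrableOn_compact (M.isCompact_cell K)]
  simp only [M.integral_pderiv, ← R.sum_edgePoint M _ (hf _)]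
  rw [Finset.sum_comm]
  refine Finset.sum_congr rfl fun e _ => ?_
  simp only [Finset.mul_sum]
  rw [Finset.sum_comm]
  exact Finset.sum_congr rfl fun i _ => Finset.sum_congr rfl fun q _ => by ring

/-- The divergence theorem for a constant field. -/
theorem sum_edges_normal_const (K : ι) (u : Vec3) :
    ∑ e ∈ M.edges K, M.length e * ∑ q, R.weight q * liftVec (M.normal K e) ⬝ᵥ u = 0 := by
  have h := sum_edges_quadrature M R K (fun i => MvPolynomial.C (u i.castSucc)) (by simp)
  simp only [MvPolynomial.pderiv_C, Finset.sum_const_zero] at h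
  simpa [pval, liftVec_dot, Fin.sum_univ_two] using h

/-- The role of the locally divergence-free space: the edge rule being exact, the discrete flux of
the interior field equals the integral of its divergence. -/
theorem sum_edges_normalB (K : ι) {U : ι → PolyVec} (hU : U K ∈ localSpace k) :
    ∑ e ∈ M.edges K, M.length e * ∑ q, R.weight q *
      normalB (M.normal K e) (intState M R U K e q) = 0 := by
  have hd : ∀ l, (U K l).totalDegree ≤ 2 * k := fun l =>
    ((MvPolynomial.mem_restrictTotalDegree _ _ _).1 (hU.1 l)).trans (by omega)
  have h := sum_edges_quadrature M R K ![U K 4, U K 5] (by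
    intro i
    fin_cases i
    exacts [hd 4, hd 5])
  simp only [Fin.sum_univ_two, Matrix.cons_val_zero, Matrix.cons_val_one] at h
  rw [hU.2] at h
  simpa [pval, normalB_eq, intState, valueAt] using h

end Quadrature

/-! ### Edge estimates -/

section EdgeEstimate

variable {H : ℝ → ℝ → ℝ}

theorem prim_isPhysical {U : State} (hU : U ∈ admissible H) : (prim H U).IsPhysical H :=
  (prim_spec hU).1

theorem cons_prim {U : State} (hU : U ∈ admissible H) : (prim H U).cons H = U :=
  (prim_spec hU).2

theorem magnetic_cons (w : Prim) : magnetic (w.cons H) = w.B := by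
  ext i
  fin_cases i <;> rfl

theorem dot_dualState_pos (hH : CausalEOS H) {U : State} (hU : U ∈ admissible H) {u : Vec3}
    (hu : u ⬝ᵥ u < 1) (b : Vec3) : 0 < U ⬝ᵥ dualState u b + magPressure u b := by
  have := (prim_isPhysical hU).dot_dualState_pos hH hu b
  rwa [cons_prim hU] at this

theorem density_pos {U : State} (hU : U ∈ admissible H) : 0 < U 0 := by
  obtain ⟨w, hw, rfl⟩ := hU
  exact mul_pos hw.1 (Prim.W_pos hw.2.2.2)

theorem normalFlux_dot_le (hH : CausalEOS H) {U : State} (hU : U ∈ admissible H) {u : Vec3}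
    (hu : u ⬝ᵥ u < 1) (b : Vec3) {n : Pt} (hn : ‖n‖ = 1) :
    normalFlux H n U ⬝ᵥ dualState u b ≤ U ⬝ᵥ dualState u b + magPressure u b
      - liftVec n ⬝ᵥ u * magPressure u b + normalB n U * u ⬝ᵥ b := by
  have h := (prim_isPhysical hU).flux_dot_dualState_nonneg hH hu b hn
  rw [← magnetic_cons (H := H), cons_prim hU, ← normalB_eq_liftVec_dot, sub_dotProduct] at h
  have e : ∑ i : Fin 2, n i • (prim H U).flux H i = normalFlux H n U := rfl
  rw [e] at h
  linarith

theorem normalFlux_zero_le {U : State} (hU : U ∈ admissible H) {n : Pt} (hn : ‖n‖ = 1) :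
    normalFlux H n U 0 ≤ U 0 := by
  obtain ⟨hρ, -, -, hv⟩ := prim_isPhysical hU
  have h0 : (prim H U).ρ * (prim H U).W = U 0 := by
    conv_rhs => rw [← cons_prim hU]
    rfl
  have h : normalFlux H n U 0 = U 0 * liftVec n ⬝ᵥ (prim H U).v := by
    rw [← h0, normalFlux, Finset.sum_apply, Fin.sum_univ_two, liftVec_dot]
    simp [flux, Prim.flux, mkState]
    ring
  rw [h]
  refine mul_le_of_le_one_right (density_pos hU).le ?_
  have hg := gram_two (liftVec n) (prim H U).v
  rw [liftVec_dot_self, hn, one_pow, one_mul] at hg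
  exact (abs_le.1 ((sq_le_one_iff_abs_le_one _).1 (hg.trans hv.le))).2

theorem source_smul_dot_le (hH : CausalEOS H) {U : State} (hU : U ∈ admissible H) {u : Vec3}
    (hu : u ⬝ᵥ u < 1) (b : Vec3) (c : ℝ) :
    c * (source H U ⬝ᵥ dualState u b) ≤ |c| * ((U ⬝ᵥ dualState u b + magPressure u b)
      / √((prim H U).ρ * (prim H U).enthalpy H)) - c * u ⬝ᵥ b := by
  have h := (prim_isPhysical hU).abs_source_dot_le hH hu b
  rw [cons_prim hU] at h
  have h1 := mul_le_mul_of_nonneg_left h (abs_nonneg c)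
  rw [← abs_mul] at h1
  have h2 := (le_abs_self _).trans h1
  rw [mul_add] at h2
  change c * (source H U ⬝ᵥ dualState u b) + c * u ⬝ᵥ b ≤ _ at h2
  linarith

variable {ι ε : Type*} (M : PolygonalMesh ι ε) {k Q : ℕ} (R : EdgeQuadrature k Q)
  (g : ε → Fin Q → State) {U : ι → PolyVec} {K : ι} {e : ε} {q : Fin Q}

/-- The viscosity cancels the exterior pairing. The fluxes leave the mean of the two values of `n ·
B` times `u · b`, and the source subtracts half the jump; only the interior value survives, which
`sum_edges_normalB` can sum. -/
theorem edgeTerm_dot_le (hH : CausalEOS H) (he : e ∈ M.edges K)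
    (hi : intState M R U K e q ∈ admissible H) (hx : extState M R g U K e q ∈ admissible H)
    {u : Vec3} (hu : u ⬝ᵥ u < 1) (b : Vec3) :
    edgeTerm H M R g U K e q ⬝ᵥ dualState u b
      ≤ (1 + jumpSpeed H M R g U K e q)
          * (intState M R U K e q ⬝ᵥ dualState u b + magPressure u b)
        - liftVec (M.normal K e) ⬝ᵥ u * magPressure u b
        + normalB (M.normal K e) (intState M R U K e q) * u ⬝ᵥ b := by
  have hn := M.norm_normal K e he
  have h1 := normalFlux_dot_le hH hi hu b hn
  have h2 := normalFlux_dot_le hH hx hu b hn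
  have h3 := source_smul_dot_le hH hi hu b ((1 / 2) * (normalB (M.normal K e)
    (extState M R g U K e q) - normalB (M.normal K e) (intState M R U K e q)))
  rw [abs_mul, abs_sub_comm, abs_of_pos (by norm_num : (0 : ℝ) < 1 / 2)] at h3
  simp only [edgeTerm, laxFriedrichs, viscosity, jumpSpeed, add_dotProduct, sub_dotProduct,
    smul_dotProduct, smul_eq_mul, one_mul]
  rw [← mul_div_assoc, mul_div_right_comm] at h3
  linarith

theorem edgeTerm_zero_le (he : e ∈ M.edges K)
    (hi : intState M R U K e q ∈ admissible H) (hx : extState M R g U K e q ∈ admissible H) :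
    edgeTerm H M R g U K e q 0 ≤ intState M R U K e q 0 := by
  have hn := M.norm_normal K e he
  have h1 := normalFlux_zero_le hi hn
  have h2 := normalFlux_zero_le hx hn
  have h3 : source H (intState M R U K e q) 0 = 0 := rfl
  simp only [edgeTerm, laxFriedrichs, viscosity, Pi.add_apply, Pi.sub_apply, Pi.smul_apply,
    smul_eq_mul, h3, mul_zero]
  linarith

end EdgeEstimate

/-! ### Cell averages of the scheme -/

section Averages

variable {ι ε : Type*} {H : ℝ → ℝ → ℝ} (M : PolygonalMesh ι ε) {k Q : ℕ}
  (R : EdgeQuadrature k Q) (C : ∀ K, CellQuadrature k (M.cell K)) (g : ε → Fin Q → State)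

theorem cellAverage_add_smul (U L : ι → PolyVec) (c : ℝ) (K : ι) :
    cellAverage M (U + c • L) K = cellAverage M U K + c • cellAverage M L K := by
  have hint : ∀ f : MvPolynomial (Fin 2) ℝ, IntegrableOn (pval f) (M.cell K) := fun f =>
    (continuous_pval f).continuousOn.integrableOn_compact (M.isCompact_cell K)
  funext l
  simp only [cellAverage, Pi.add_apply, Pi.smul_apply, pval_add, pval_smul, smul_eq_mul]
  rw [integral_add (hint _) ((hint _).const_mul c), integral_const_mul]
  ring

/-- The cell averages of the operator are the averaged edge terms. -/
theorem cellAverage_dgOperator (U : ι → PolyVec) (K : ι) :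
    cellAverage M (dgOperator H M R C g U) K
      = -((M.area K)⁻¹ • ∑ e ∈ M.edges K, M.length e •
          ∑ q, R.weight q • edgeTerm H M R g U K e q) := by
  funext l
  -- Constants satisfy the divergence constraint, so they are legitimate test functions, and the
  -- element integral vanishes on them.
  set u : PolyVec := Pi.single l 1 with hu
  have hval : ∀ x, valueAt u x = Pi.single l 1 := fun x => by
    funext j
    by_cases h : j = l
    · subst h; simp [valueAt, pval, hu]
    · simp [valueAt, pval, hu, h]
  have hder : ∀ (i : Fin 2) (j : Fin 8), MvPolynomial.pderiv i (u j) = 0 := fun i j => by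
    by_cases h : j = l
    · subst h; simp [hu]
    · simp [hu, h]
  have hmem : u ∈ localSpace k := by
    refine ⟨fun j => ?_, by rw [hder, hder, add_zero]⟩
    rw [MvPolynomial.mem_restrictTotalDegree]
    by_cases h : j = l
    · subst h; simp [hu]
    · simp [hu, h]
  have h := (dgOperator_spec H M R C g U K).2 u hmem
  have hz : ∀ x, valueAt (fun _ => (0 : MvPolynomial (Fin 2) ℝ)) x = 0 := fun x => by
    funext j; simp [valueAt, pval]
  simp only [rhs, hval, hder, hz, dotProduct_zero, Finset.sum_const_zero, mul_zero, add_zero,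
    dotProduct_single, mul_one] at h
  simp only [valueAt] at h
  rw [cellAverage, h]
  simp only [Pi.neg_apply, Pi.smul_apply, Finset.sum_apply, smul_eq_mul, mul_neg]

theorem cellAverage_eq_quadrature (P : ∀ K, SpecialQuadrature M R K) {U : ι → PolyVec} {K : ι}
    (hU : U K ∈ localSpace k) :
    cellAverage M U K = ∑ e ∈ M.edges K, ∑ q, (P K).edgeWeight e q • intState M R U K e q
      + ∑ q, (P K).weight q • valueAt (U K) ((P K).node q) := by
  funext l
  rw [cellAverage, (P K).exact_average _ ((MvPolynomial.mem_restrictTotalDegree _ _ _).1 (hU.1 l))]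
  simp [Finset.sum_apply, intState, valueAt]

theorem SpecialQuadrature.sum_weight {R : EdgeQuadrature k Q} {K : ι}
    (P : SpecialQuadrature M R K) :
    ∑ e ∈ M.edges K, ∑ q, P.edgeWeight e q + ∑ q, P.weight q = 1 := by
  have h := P.exact_average 1 (by simp)
  have h1 : ∀ x, pval 1 x = 1 := fun x => by simp [pval]
  simp only [h1, mul_one, integral_const, smul_eq_mul, measureReal_restrict_apply_univ] at h
  rw [← h]
  exact inv_mul_cancel₀ (M.area_pos K).ne'

/-- One forward Euler step of the cell average, as a quadrature sum. -/
theorem cellAverage_step (P : ∀ K, SpecialQuadrature M R K) {U : ι → PolyVec} {K : ι}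
    (hU : U K ∈ localSpace k) (Δt : ℝ) :
    cellAverage M (U + Δt • dgOperator H M R C g U) K
      = ∑ e ∈ M.edges K, ∑ q, ((P K).edgeWeight e q • intState M R U K e q
          - (Δt * (M.length e / M.area K) * R.weight q) • edgeTerm H M R g U K e q)
        + ∑ q, (P K).weight q • valueAt (U K) ((P K).node q) := by
  rw [cellAverage_add_smul, cellAverage_dgOperator, cellAverage_eq_quadrature M R P hU]
  simp only [Finset.sum_sub_distrib, Finset.smul_sum, smul_smul, smul_neg]
  have : ∀ e q, Δt * ((M.area K)⁻¹ * (M.length e * R.weight q))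
      = Δt * (M.length e / M.area K) * R.weight q := fun e q => by ring
  simp only [this]
  abel

end Averages

/-! ### Admissibility of the point values that enter the scheme -/

section Admissible

variable {ι ε : Type*} {H : ℝ → ℝ → ℝ} {M : PolygonalMesh ι ε} {k Q : ℕ}
  {R : EdgeQuadrature k Q} {C : ∀ K, CellQuadrature k (M.cell K)}
  {P : ∀ K, SpecialQuadrature M R K} {g : ε → Fin Q → State} {U : ι → PolyVec}

theorem intState_mem_admissible (hU : U ∈ admissiblePointwise H M R C P) {K : ι} {e : ε}
    (he : e ∈ M.edges K) (q : Fin Q) : intState M R U K e q ∈ admissible H :=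
  hU.2 K _ (Or.inl (Or.inl ⟨e, he, q, rfl⟩))

theorem node_mem_admissible (hU : U ∈ admissiblePointwise H M R C P) (K : ι)
    (q : Fin (P K).card) : valueAt (U K) ((P K).node q) ∈ admissible H :=
  hU.2 K _ (Or.inl (Or.inr ⟨q, rfl⟩))

theorem extState_mem_admissible (hU : U ∈ admissiblePointwise H M R C P)
    (hg : ∀ K, ∀ e ∈ M.edges K, (∀ K', K' ≠ K → e ∉ M.edges K') → ∀ q, g e q ∈ admissible H)
    {K : ι} {e : ε} (he : e ∈ M.edges K) (q : Fin Q) :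
    extState M R g U K e q ∈ admissible H := by
  unfold extState
  split_ifs with h
  · exact intState_mem_admissible hU h.choose_spec.2 q
  · push Not at h
    exact hg K e he h q

end Admissible

end RMHD

/-! ### The weak physical-constraint-preserving property -/

theorem mainTheorem1 {ι ε : Type*} (H : ℝ → ℝ → ℝ) (hH : RMHD.CausalEOS H)
    (M : RMHD.PolygonalMesh ι ε) (k Q : ℕ) (R : RMHD.EdgeQuadrature k Q)
    (C : ∀ K, RMHD.CellQuadrature k (M.cell K)) (P : ∀ K, RMHD.SpecialQuadrature M R K)
    (g : ε → Fin Q → RMHD.State)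
    (hg : ∀ K, ∀ e ∈ M.edges K, (∀ K', K' ≠ K → e ∉ M.edges K') →
      ∀ q, g e q ∈ RMHD.admissible H)
    (U : ι → RMHD.PolyVec) (hU : U ∈ RMHD.admissiblePointwise H M R C P)
    (Δt : ℝ) (hΔt : 0 < Δt)
    (hCFL : ∀ K, ∀ e ∈ M.edges K, ∀ q,
      Δt * (M.length e / M.area K) * (RMHD.viscosity + RMHD.jumpSpeed H M R g U K e q)
        < (P K).edgeWeight e q / R.weight q) :
    U + Δt • RMHD.dgOperator H M R C g U ∈ RMHD.admissibleAverages H M k := by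
  open RMHD in
  have hL : dgOperator H M R C g U ∈ dgSpace ι k := fun K _ => (dgOperator_spec H M R C g U K).1
  refine ⟨Submodule.add_mem _ hU.1.1 (Submodule.smul_mem _ _ hL), fun K => ?_⟩
  have hK : U K ∈ localSpace k := hU.1.1 K trivial
  have hi := fun e (he : e ∈ M.edges K) q => intState_mem_admissible hU he q
  have hx := fun e (he : e ∈ M.edges K) q => extState_mem_admissible hU hg he q
  have hnode := fun q => node_mem_admissible hU K q
  have hc0 : ∀ e q, 0 ≤ Δt * (M.length e / M.area K) * R.weight q := fun e q =>
    mul_nonneg (mul_nonneg hΔt.le (div_nonneg dist_nonneg (M.area_pos K).le))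
      (R.weight_pos q).le
  have hσ : ∀ e q, 0 ≤ jumpSpeed H M R g U K e q := fun e q => by
    unfold jumpSpeed; positivity
  have hcfl : ∀ e ∈ M.edges K, ∀ q, Δt * (M.length e / M.area K) * R.weight q
      * (1 + jumpSpeed H M R g U K e q) < (P K).edgeWeight e q := fun e he q => by
    have h := (lt_div_iff₀ (R.weight_pos q)).1 (hCFL K e he q)
    rw [viscosity] at h
    linarith
  have hpos : ∀ {F : ε → Fin Q → ℝ} {G : Fin (P K).card → ℝ},
      (∀ e ∈ M.edges K, ∀ q, 0 < F e q) → (∀ q, 0 ≤ G q) →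
      0 < ∑ e ∈ M.edges K, ∑ q, F e q + ∑ q, G q := fun hF hG =>
    add_pos_of_pos_of_nonneg
      (Finset.sum_pos (fun e he => Finset.sum_pos (fun q _ => hF e he q) R.univ_nonempty)
        (M.edges_nonempty K))
      (Finset.sum_nonneg fun q _ => hG q)
  rw [show cellAverage M (U + Δt • dgOperator H M R C g U) K = _ from
    cellAverage_step M R C g P hK Δt]
  refine mem_admissible_of_dot_dualState_pos hH ?_ fun u b hu => ?_
  · simp only [Pi.add_apply, Finset.sum_apply, Pi.sub_apply, Pi.smul_apply, smul_eq_mul]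
    refine hpos (fun e he q => ?_) fun q =>
      mul_nonneg ((P K).weight_pos q).le (density_pos (hnode q)).le
    have h1 := mul_le_mul_of_nonneg_left (edgeTerm_zero_le M R g he (hi e he q) (hx e he q))
      (hc0 e q)
    have h2 : Δt * (M.length e / M.area K) * R.weight q < (P K).edgeWeight e q :=
      lt_of_le_of_lt (le_mul_of_one_le_right (hc0 e q) (by linarith [hσ e q])) (hcfl e he q)
    have h3 := mul_lt_mul_of_pos_right h2 (density_pos (hi e he q))
    linarith
  -- The part of the edge bounds without a sign at individual points; it cancels only in the sum
  -- over the boundary of the cell.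
  · have hflux : ∑ e ∈ M.edges K, ∑ q, Δt * (M.length e / M.area K) * R.weight q
        * (liftVec (M.normal K e) ⬝ᵥ u * magPressure u b
          - normalB (M.normal K e) (intState M R U K e q) * u ⬝ᵥ b) = 0 := by
      have h1 := sum_edges_normal_const M R K u
      have h2 := sum_edges_normalB M R K hK
      have h3 : ∀ e q, Δt * (M.length e / M.area K) * R.weight q
          * (liftVec (M.normal K e) ⬝ᵥ u * magPressure u b
            - normalB (M.normal K e) (intState M R U K e q) * u ⬝ᵥ b)
          = Δt / M.area K * magPressure u b
              * (M.length e * (R.weight q * liftVec (M.normal K e) ⬝ᵥ u))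
            - Δt / M.area K * u ⬝ᵥ b * (M.length e
              * (R.weight q * normalB (M.normal K e) (intState M R U K e q))) :=
        fun e q => by ring
      simp only [h3, Finset.sum_sub_distrib, ← Finset.mul_sum, h1, h2, mul_zero, sub_zero]
    -- The special weights sum to 1, so the constant term of the affine functional can be
    -- distributed over the quadrature points.
    have hw : magPressure u b = ∑ e ∈ M.edges K, ∑ q, (P K).edgeWeight e q * magPressure u b
        + ∑ q, (P K).weight q * magPressure u b := by
      simp only [← Finset.sum_mul]
      rw [← add_mul, (P K).sum_weight, one_mul]
    have key := hpos (F := fun e q => ((P K).edgeWeight e q - Δt * (M.length e / M.area K)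
        * R.weight q * (1 + jumpSpeed H M R g U K e q))
        * (intState M R U K e q ⬝ᵥ dualState u b + magPressure u b))
      (G := fun q => (P K).weight q
        * (valueAt (U K) ((P K).node q) ⬝ᵥ dualState u b + magPressure u b))
      (fun e he q => mul_pos (sub_pos.2 (hcfl e he q)) (dot_dualState_pos hH (hi e he q) hu b))
      (fun q => mul_nonneg ((P K).weight_pos q).le (dot_dualState_pos hH (hnode q) hu b).le)
    refine key.trans_le ?_
    rw [← add_zero (∑ e ∈ M.edges K, _), ← hflux, ← Finset.sum_add_distrib]
    simp only [← Finset.sum_add_distrib]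
    -- The fourth occurrence is the free-standing magnetic pressure added to the pairing of the new
    -- average.
    nth_rewrite 4 [hw]
    simp only [add_dotProduct, sum_dotProduct, sub_dotProduct, smul_dotProduct, smul_eq_mul]
    rw [add_add_add_comm]
    simp only [← Finset.sum_add_distrib]
    refine add_le_add (Finset.sum_le_sum fun e he => Finset.sum_le_sum fun q _ => ?_)
      (le_of_eq (Finset.sum_congr rfl fun q _ => by ring))
    have h := mul_le_mul_of_nonneg_left
      (edgeTerm_dot_le M R g hH he (hi e he q) (hx e he q) hu b) (hc0 e q)
    linarith
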